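/- Indices $\lambda,\alpha,\beta,\mu,\dots$ run over $\{0,1,2,3\}$ and repeated indices are summed. Let $R=(R^{\lambda\alpha}_{\beta\mu})$ be complex numbers, and let $\mathcal A_R$ be the unital complex $*$-algebra generated by hermitian elements $x_1^\lambda$, $x_2^\alpha$ with relations $$x_1^\lambda x_1^\mu=x_1^\mu x_1^\lambda,\quad x_2^\alpha x_2^\beta=x_2^\beta x_2^\alpha,\quad x_1^\lambda x_2^\alpha=R^{\lambda\alpha}_{\beta\mu}\,x_2^\beta x_1^\mu,\quad x_2^\alpha x_1^\lambda=\overline{R^{\lambda\alpha}_{\beta\mu}}\,x_1^\mu x_2^\beta .$$ Write these relations as $x^ax^b=\mathcal R^{ab}_{cd}\,x^cx^d$ for the eight generators $x^a$. Assume that $\overline{R^{\lambda\alpha}_{\beta\mu}}R^{\mu\beta}_{\gamma\nu}=\delta^\lambda_\nu\delta^\alpha_\gamma$, that $\mathcal R$ satisfies the Yang–Baxter equation $(\mathcal R\otimes I)(I\otimes\mathcal R)(\mathcal R\otimes I)=(I\otimes\mathcal R)(\mathcal R\otimes I)(I\otimes\mathcal R)$, and that $(x_1)^2=\sum_\lambda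 (x_1^\lambda)^2$ and $(x_2)^2=\sum_\alpha (x_2^\alpha)^2$ are central in $\mathcal A_R$. Put $\mathcal A(S^7_R)=\mathcal A_R/\big((x_1)^2+(x_2)^2-1\big)$. Let $e_0=1,e_1,e_2,e_3$ be the standard basis of the quaternions $\mathbb H$, and put $x_i=x_i^\mu e_\mu\in\mathcal A(S^7_R)\otimes_{\mathbb R}\mathbb H$ and $|\psi\rangle=\binom{x_2}{x_1}$. Let $p=|\psi\rangle\langle\psi|$, a $2\times2$ matrix with entries in $\mathcal A(S^7_R)\otimes_{\mathbb R}\mathbb H$, and let $\mathcal A(S^4_R)\subseteq\mathcal A(S^7_R)$ be the unital $*$-subalgebra generated by the quaternionic components of the entries of $p$. Let $\mathcal A(SU(2))=\mathbb C[w^0,w^1,w^2,w^3]/\big(\sum_\mu (w^\mu)^2-1\big)$ be the Hopf $*$-algebra of coordinate functions on the group $SU(2)$ of unit quaternions $w=w^\mu e_\mu$ (the $w^\mu$ are hermitian, and the coproduct is dual to multiplication of quaternions). **Proposition.** Assume that for every unit quaternion $w\in SU(2)$ there is a $*$-automorphism $\alpha_w$ of $\mathcal A(S^7_R)$ with $\alpha_w(|\psi\rangle)=|\psi\rangle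 w$, that is, $\alpha_w(x_i^\mu)$ is the $e_\mu$-component of $x_iw$ for $i=1,2$ and all $\mu$. Then there is a right coaction $\delta:\mathcal A(S^7_R)\to\mathcal A(S^7_R)\otimes\mathcal A(SU(2))$ of the Hopf algebra $\mathcal A(SU(2))$ that is a homomorphism of $*$-algebras and is dual to the action, i.e. $(\mathrm{id}\otimes\mathrm{ev}_w)\circ\delta=\alpha_w$ for all $w\in SU(2)$; on generators, $\delta(|\psi\rangle)=|\psi\rangle\otimes w$ (with $w=w^\mu e_\mu$ here the quaternion of coordinate functions). For this $\delta$ the inclusion $\mathcal A(S^4_R)\subseteq\mathcal A(S^7_R)$ is a Hopf–Galois extension: $\mathcal A(S^4_R)=\{f\in\mathcal A(S^7_R):\delta(f)=f\otimes1\}$, and the canonical map $$\chi:\mathcal A(S^7_R)\otimes_{\mathcal A(S^4_R)}\mathcal A(S^7_R)\to\mathcal A(S^7_R)\otimes\mathcal A(SU(2)),\qquad \chi(f'\otimes f)=(f'\otimes1)\,\delta(f),$$ is bijective. -/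

import Mathlib

open scoped TensorProduct Quaternion ComplexConjugate

noncomputable section

namespace QuaternionicSphere

/-! ### Quaternions with noncommuting coefficients

An element `a 0 e₀ + a 1 e₁ + a 2 e₂ + a 3 e₃` of `A ⊗ ℍ` is given by its coordinates
`a : Fin 4 → A`. -/

/-- The product of `A ⊗ ℍ` (the coefficients multiply in `A`, the units `e₀ = 1`, `e₁`, `e₂`, `e₃`
by `e_a e_b = - δ_ab + ε_abc e_c`). -/
def qmul {A : Type*} [Ring A] (a b : Fin 4 → A) : Fin 4 → A :=
  ![a 0 * b 0 - a 1 * b 1 - a 2 * b 2 - a 3 * b 3,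
    a 0 * b 1 + a 1 * b 0 + a 2 * b 3 - a 3 * b 2,
    a 0 * b 2 - a 1 * b 3 + a 2 * b 0 + a 3 * b 1,
    a 0 * b 3 + a 1 * b 2 - a 2 * b 1 + a 3 * b 0]

/-- The adjoint of `A ⊗ ℍ`: the star of `A` combined with quaternionic conjugation. -/
def qstar {A : Type*} [Ring A] [Star A] (a : Fin 4 → A) : Fin 4 → A :=
  ![star (a 0), -star (a 1), -star (a 2), -star (a 3)]

/-- The four real coordinates of a quaternion. -/
def qcoord (w : ℍ[ℝ]) : Fin 4 → ℝ := ![w.re, w.imI, w.imJ, w.imK]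

/-- The coordinates of a quaternion, as scalars of a complex algebra. -/
def qscalar (A : Type*) [Ring A] [Algebra ℂ A] (w : ℍ[ℝ]) : Fin 4 → A :=
  fun μ => algebraMap ℂ A ((qcoord w μ : ℝ) : ℂ)

/-! ### The quadratic algebra of a matrix `R` -/

/-- Index set of the eight generators: `Sum.inl l` for `x₁ˡ` and `Sum.inr a` for `x₂ᵃ`. -/
abbrev Idx : Type := Fin 4 ⊕ Fin 4

/-- A deformation matrix; `R l a b m` is the entry with upper indices `l a` and lower indices
`b m`. -/
abbrev DefMatrix : Type := Fin 4 → Fin 4 → Fin 4 → Fin 4 → ℂ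

/-- The relations between the generators of the quadratic algebra. -/
inductive QuadRel (R : DefMatrix) : FreeAlgebra ℂ Idx → FreeAlgebra ℂ Idx → Prop
  | comm₁ (l m : Fin 4) : QuadRel R
      (FreeAlgebra.ι ℂ (Sum.inl l) * FreeAlgebra.ι ℂ (Sum.inl m))
      (FreeAlgebra.ι ℂ (Sum.inl m) * FreeAlgebra.ι ℂ (Sum.inl l))
  | comm₂ (a b : Fin 4) : QuadRel R
      (FreeAlgebra.ι ℂ (Sum.inr a) * FreeAlgebra.ι ℂ (Sum.inr b))
      (FreeAlgebra.ι ℂ (Sum.inr b) * FreeAlgebra.ι ℂ (Sum.inr a))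
  | mixed (l a : Fin 4) : QuadRel R
      (FreeAlgebra.ι ℂ (Sum.inl l) * FreeAlgebra.ι ℂ (Sum.inr a))
      (∑ b, ∑ m, algebraMap ℂ _ (R l a b m) *
        (FreeAlgebra.ι ℂ (Sum.inr b) * FreeAlgebra.ι ℂ (Sum.inl m)))
  | mixed' (l a : Fin 4) : QuadRel R
      (FreeAlgebra.ι ℂ (Sum.inr a) * FreeAlgebra.ι ℂ (Sum.inl l))
      (∑ b, ∑ m, algebraMap ℂ _ (conj (R l a b m)) *
        (FreeAlgebra.ι ℂ (Sum.inl m) * FreeAlgebra.ι ℂ (Sum.inr b)))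

/-- The quadratic algebra `𝒜_R`. -/
def QuadAlg (R : DefMatrix) : Type := RingQuot (QuadRel R)

namespace QuadAlg

variable (R : DefMatrix)

instance : Ring (QuadAlg R) := inferInstanceAs (Ring (RingQuot (QuadRel R)))

instance : Algebra ℂ (QuadAlg R) := inferInstanceAs (Algebra ℂ (RingQuot (QuadRel R)))

/-- The quotient map from the free algebra. -/
def mk : FreeAlgebra ℂ Idx →ₐ[ℂ] QuadAlg R := RingQuot.mkAlgHom ℂ (QuadRel R)

/-- The generators of `𝒜_R`. -/
def gen (i : Idx) : QuadAlg R := mk R (FreeAlgebra.ι ℂ i)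

theorem mk_surjective : Function.Surjective (mk R) := RingQuot.mkAlgHom_surjective ℂ _

theorem mk_rel {a b : FreeAlgebra ℂ Idx} (h : QuadRel R a b) : mk R a = mk R b :=
  RingQuot.mkAlgHom_rel ℂ h

/-- The opposite algebra with the conjugate complex structure. -/
def ConjOp : Type := (QuadAlg R)ᵐᵒᵖ

instance : Ring (ConjOp R) := inferInstanceAs (Ring (QuadAlg R)ᵐᵒᵖ)

instance : Algebra ℂ (ConjOp R) :=
  RingHom.toAlgebra' ((algebraMap ℂ (QuadAlg R)ᵐᵒᵖ).comp (starRingEnd ℂ))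
    (fun c x => Algebra.commutes (A := (QuadAlg R)ᵐᵒᵖ) (conj c) x)

/-- An element of `𝒜_R`, seen in the opposite conjugate algebra. -/
def toConjOp (a : QuadAlg R) : ConjOp R := (MulOpposite.op a : (QuadAlg R)ᵐᵒᵖ)

/-- The conjugate linear antimultiplicative map that fixes the generators, on the free algebra. -/
def preStar : FreeAlgebra ℂ Idx →ₐ[ℂ] ConjOp R :=
  FreeAlgebra.lift ℂ (fun i => toConjOp R (gen R i))

theorem unop_preStar_mul (a b : FreeAlgebra ℂ Idx) :
    MulOpposite.unop (preStar R (a * b)) =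
      MulOpposite.unop (preStar R b) * MulOpposite.unop (preStar R a) := by
  rw [map_mul]; rfl

theorem unop_preStar_ι (i : Idx) :
    MulOpposite.unop (preStar R (FreeAlgebra.ι ℂ i)) = gen R i := by
  unfold preStar; rw [FreeAlgebra.lift_ι_apply]; rfl

theorem unop_preStar_add (a b : FreeAlgebra ℂ Idx) :
    MulOpposite.unop (preStar R (a + b)) =
      MulOpposite.unop (preStar R a) + MulOpposite.unop (preStar R b) := by
  rw [map_add]; rfl

theorem unop_preStar_algebraMap (c : ℂ) :
    MulOpposite.unop (preStar R (algebraMap ℂ _ c)) = algebraMap ℂ _ (conj c) := by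
  rw [AlgHom.commutes]; rfl

theorem unop_preStar_sum {ι : Type} (s : Finset ι) (f : ι → FreeAlgebra ℂ Idx) :
    MulOpposite.unop (preStar R (∑ i ∈ s, f i)) =
      ∑ i ∈ s, MulOpposite.unop (preStar R (f i)) := by
  classical
  induction s using Finset.induction_on with
  | empty => simp only [Finset.sum_empty, map_zero]; rfl
  | insert a s ha ih => rw [Finset.sum_insert ha, Finset.sum_insert ha, unop_preStar_add, ih]

theorem preStar_rel {a b : FreeAlgebra ℂ Idx} (h : QuadRel R a b) :
    preStar R a = preStar R b := by
  apply MulOpposite.unop_injective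
  cases h with
  | comm₁ l m =>
    simp only [unop_preStar_mul, unop_preStar_ι]
    simpa [gen] using mk_rel R (QuadRel.comm₁ (R := R) m l)
  | comm₂ l m =>
    simp only [unop_preStar_mul, unop_preStar_ι]
    simpa [gen] using mk_rel R (QuadRel.comm₂ (R := R) m l)
  | mixed l a =>
    simp only [unop_preStar_sum, unop_preStar_mul, unop_preStar_ι, unop_preStar_algebraMap]
    have := mk_rel R (QuadRel.mixed' (R := R) l a)
    simp only [map_mul, map_sum, AlgHom.commutes] at this
    simp only [gen, this]
    exact Finset.sum_congr rfl fun b _ => Finset.sum_congr rfl fun m _ => Algebra.commutes _ _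
  | mixed' l a =>
    simp only [unop_preStar_sum, unop_preStar_mul, unop_preStar_ι, unop_preStar_algebraMap]
    have := mk_rel R (QuadRel.mixed (R := R) l a)
    simp only [map_mul, map_sum, AlgHom.commutes] at this
    simp only [gen, this, Complex.conj_conj]
    exact Finset.sum_congr rfl fun b _ => Finset.sum_congr rfl fun m _ => Algebra.commutes _ _

/-- The conjugate linear antimultiplicative map that fixes the generators. -/
def starHom : QuadAlg R →ₐ[ℂ] ConjOp R :=
  RingQuot.liftAlgHom ℂ ⟨preStar R, fun _ _ h => preStar_rel R h⟩

theorem starHom_mk (a : FreeAlgebra ℂ Idx) : starHom R (mk R a) = preStar R a :=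
  RingQuot.liftAlgHom_mkAlgHom_apply ℂ (preStar R) (fun _ _ h => preStar_rel R h) a

/-- The star of `𝒜_R`: conjugate linear, antimultiplicative, and the generators are hermitian. -/
instance : Star (QuadAlg R) := ⟨fun a => MulOpposite.unop (starHom R a)⟩

theorem star_def (a : QuadAlg R) : star a = MulOpposite.unop (starHom R a) := rfl

theorem star_add' (a b : QuadAlg R) : star (a + b) = star a + star b := by
  simp only [star_def, map_add]; rfl

theorem star_mul' (a b : QuadAlg R) : star (a * b) = star b * star a := by
  simp only [star_def, map_mul]; rfl

@[simp] theorem star_gen (i : Idx) : star (gen R i) = gen R i := by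
  rw [star_def, gen, starHom_mk, unop_preStar_ι]; rfl

theorem star_algebraMap' (c : ℂ) :
    star (algebraMap ℂ (QuadAlg R) c) = algebraMap ℂ (QuadAlg R) (conj c) := by
  rw [star_def, AlgHom.commutes]; rfl

theorem star_star' (a : QuadAlg R) : star (star a) = a := by
  obtain ⟨a, rfl⟩ := mk_surjective R a
  induction a using FreeAlgebra.induction with
  | grade0 c => rw [AlgHom.commutes, star_algebraMap', star_algebraMap', Complex.conj_conj]
  | grade1 i => exact (congrArg star (star_gen R i)).trans (star_gen R i)
  | mul a b ha hb => rw [map_mul, star_mul', star_mul', ha, hb]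
  | add a b ha hb => rw [map_add, star_add', star_add', ha, hb]

instance : StarRing (QuadAlg R) where
  star_involutive := star_star' R
  star_mul := star_mul' R
  star_add := star_add' R

instance : StarModule ℂ (QuadAlg R) where
  star_smul c a := by
    rw [Algebra.smul_def, star_mul', star_algebraMap', Algebra.smul_def]
    exact (Algebra.commutes _ _).symm

/-- The coordinates `x₁⁰, …, x₁³`. -/
def x₁ (l : Fin 4) : QuadAlg R := gen R (Sum.inl l)

/-- The coordinates `x₂⁰, …, x₂³`. -/
def x₂ (a : Fin 4) : QuadAlg R := gen R (Sum.inr a)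

/-- The quadratic element `(x₁)²`. -/
def sq₁ : QuadAlg R := ∑ l, x₁ R l ^ 2

/-- The quadratic element `(x₂)²`. -/
def sq₂ : QuadAlg R := ∑ a, x₂ R a ^ 2

end QuadAlg

/-! ### The conditions on the deformation matrix -/

/-- The matrix `ℛ` for which the relations of `𝒜_R` read `xᵃ xᵇ = ∑ ℛ (a, b) (c, d) xᶜ xᵈ`. -/
def bigR (R : DefMatrix) : Matrix (Idx × Idx) (Idx × Idx) ℂ
  | (Sum.inl l, Sum.inl m), (Sum.inl m', Sum.inl l') => if l = l' ∧ m = m' then 1 else 0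
  | (Sum.inr a, Sum.inr b), (Sum.inr b', Sum.inr a') => if a = a' ∧ b = b' then 1 else 0
  | (Sum.inl l, Sum.inr a), (Sum.inr b, Sum.inl m) => R l a b m
  | (Sum.inr a, Sum.inl l), (Sum.inl m, Sum.inr b) => conj (R l a b m)
  | _, _ => 0

/-- `T ⊗ I`, on the triple tensor power. -/
def leg₁₂ (T : Matrix (Idx × Idx) (Idx × Idx) ℂ) :
    Matrix (Idx × Idx × Idx) (Idx × Idx × Idx) ℂ :=
  fun i j => if i.2.2 = j.2.2 then T (i.1, i.2.1) (j.1, j.2.1) else 0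

/-- `I ⊗ T`, on the triple tensor power. -/
def leg₂₃ (T : Matrix (Idx × Idx) (Idx × Idx) ℂ) :
    Matrix (Idx × Idx × Idx) (Idx × Idx × Idx) ℂ :=
  fun i j => if i.1 = j.1 then T i.2 j.2 else 0

/-- The conditions imposed on a deformation matrix. -/
structure IsDeformation (R : DefMatrix) : Prop where
  /-- Reality (so that `ℛ` is involutive). -/
  real : ∀ l a c n, ∑ b, ∑ m, conj (R l a b m) * R m b c n = if l = n ∧ a = c then 1 else 0
  /-- The Yang–Baxter equation for `ℛ`. -/
  yangBaxter : leg₁₂ (bigR R) * leg₂₃ (bigR R) * leg₁₂ (bigR R) =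
    leg₂₃ (bigR R) * leg₁₂ (bigR R) * leg₂₃ (bigR R)
  /-- `(x₁)²` is central. -/
  central₁ : QuadAlg.sq₁ R ∈ Subalgebra.center ℂ (QuadAlg R)
  /-- `(x₂)²` is central. -/
  central₂ : QuadAlg.sq₂ R ∈ Subalgebra.center ℂ (QuadAlg R)

/-! ### The seven-sphere and the four-sphere -/

/-- The relation `(x₁)² + (x₂)² = 1`. -/
inductive SphereRel (R : DefMatrix) : QuadAlg R → QuadAlg R → Prop
  | unit : SphereRel R (QuadAlg.sq₁ R + QuadAlg.sq₂ R) 1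

theorem SphereRel.star_rel (R : DefMatrix) (a b : QuadAlg R) (h : SphereRel R a b) :
    SphereRel R (star a) (star b) := by
  cases h
  have h₁ : star (QuadAlg.sq₁ R + QuadAlg.sq₂ R) = QuadAlg.sq₁ R + QuadAlg.sq₂ R := by
    simp [QuadAlg.sq₁, QuadAlg.sq₂, QuadAlg.x₁, QuadAlg.x₂]
  rw [h₁, star_one]
  exact SphereRel.unit

/-- The coordinate algebra `𝒜(S⁷_R)`. -/
def Sphere7 (R : DefMatrix) : Type := RingQuot (SphereRel R)

namespace Sphere7

variable (R : DefMatrix)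

instance : Ring (Sphere7 R) := inferInstanceAs (Ring (RingQuot (SphereRel R)))

instance : Algebra ℂ (Sphere7 R) := inferInstanceAs (Algebra ℂ (RingQuot (SphereRel R)))

/-- The star inherited from `𝒜_R`. -/
instance : StarRing (Sphere7 R) := RingQuot.starRing (SphereRel R) (SphereRel.star_rel R)

/-- The quotient map `𝒜_R → 𝒜(S⁷_R)`. -/
def mk : QuadAlg R →ₐ[ℂ] Sphere7 R := RingQuot.mkAlgHom ℂ (SphereRel R)

theorem mk_surjective : Function.Surjective (mk R) := RingQuot.mkAlgHom_surjective ℂ _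

theorem star_mk (a : QuadAlg R) : star (mk R a) = mk R (star a) := by
  simp only [mk, RingQuot.mkAlgHom_def, RingQuot.mkRingHom_def]
  rfl

instance : StarModule ℂ (Sphere7 R) where
  star_smul c a := by
    obtain ⟨a, rfl⟩ := mk_surjective R a
    rw [← map_smul, star_mk, star_smul, map_smul, star_mk]

/-- The coordinates of `S⁷_R`. -/
def x (i : Idx) : Sphere7 R := mk R (QuadAlg.gen R i)

/-- The vector `|ψ⟩ = (x₂, x₁)`, with entries in `𝒜(S⁷_R) ⊗ ℍ`. -/
def ket : Fin 2 → Fin 4 → Sphere7 R :=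
  ![fun a => x R (Sum.inr a), fun l => x R (Sum.inl l)]

/-- The projection `p = |ψ⟩⟨ψ|`, with entries in `𝒜(S⁷_R) ⊗ ℍ`. -/
def proj (i j : Fin 2) : Fin 4 → Sphere7 R := qmul (ket R i) (qstar (ket R j))

/-- The coordinate algebra `𝒜(S⁴_R)`: the unital `*`-subalgebra generated by the entries of `p`. -/
def fourSphere : StarSubalgebra ℂ (Sphere7 R) :=
  StarAlgebra.adjoin ℂ {y | ∃ i j μ, y = proj R i j μ}

end Sphere7

/-! ### The Hopf `*`-algebra of coordinates of `SU(2)` -/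

/-- The ideal of the unit sphere in the space of quaternions. -/
def su2Ideal : Ideal (MvPolynomial (Fin 4) ℂ) :=
  Ideal.span {∑ μ, MvPolynomial.X μ ^ 2 - 1}

/-- `𝒜(SU(2))`, with `SU(2)` the group of unit quaternions: the commutative algebra generated by the
real coordinates `w⁰, …, w³` with the relation `∑ (w^μ)² = 1`. -/
def CoordSU2 : Type := MvPolynomial (Fin 4) ℂ ⧸ su2Ideal

namespace CoordSU2

instance : CommRing CoordSU2 := inferInstanceAs (CommRing (_ ⧸ su2Ideal))

instance instAlg : Algebra ℂ CoordSU2 := inferInstanceAs (Algebra ℂ (_ ⧸ su2Ideal))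

/-- The quotient map from polynomials. -/
def mk : MvPolynomial (Fin 4) ℂ →ₐ[ℂ] CoordSU2 := Ideal.Quotient.mkₐ ℂ su2Ideal

theorem mk_surjective : Function.Surjective mk := Ideal.Quotient.mkₐ_surjective ℂ su2Ideal

/-- The coordinate functions `w^μ`. -/
def w (μ : Fin 4) : CoordSU2 := mk (MvPolynomial.X μ)

theorem w_rel : w 0 ^ 2 + w 1 ^ 2 + w 2 ^ 2 + w 3 ^ 2 = 1 := by
  have h : mk (∑ μ, MvPolynomial.X μ ^ 2 - 1) = 0 :=
    Ideal.Quotient.eq_zero_iff_mem.2 (Ideal.subset_span rfl)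
  rw [map_sub, map_one, sub_eq_zero] at h
  simpa [Fin.sum_univ_four, w] using h

/-- Algebra maps out of `𝒜(SU(2))`. -/
def lift {A : Type*} [CommRing A] [Algebra ℂ A] (f : Fin 4 → A)
    (hf : f 0 ^ 2 + f 1 ^ 2 + f 2 ^ 2 + f 3 ^ 2 = 1) : CoordSU2 →ₐ[ℂ] A :=
  Ideal.Quotient.liftₐ su2Ideal (MvPolynomial.aeval f) (by
    intro a ha
    have : su2Ideal ≤ RingHom.ker (MvPolynomial.aeval (R := ℂ) f) := by
      rw [su2Ideal, Ideal.span_le, Set.singleton_subset_iff]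
      simp [RingHom.mem_ker, Fin.sum_univ_four, hf]
    exact this ha)

@[simp] theorem lift_w {A : Type*} [CommRing A] [Algebra ℂ A] (f : Fin 4 → A)
    (hf : f 0 ^ 2 + f 1 ^ 2 + f 2 ^ 2 + f 3 ^ 2 = 1) (μ : Fin 4) : lift f hf (w μ) = f μ := by
  have : lift f hf (w μ) = MvPolynomial.aeval f (MvPolynomial.X μ : MvPolynomial (Fin 4) ℂ) := rfl
  rw [this, MvPolynomial.aeval_X]

theorem hom_ext {A : Type*} [Semiring A] [Algebra ℂ A] {f g : CoordSU2 →ₐ[ℂ] A}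
    (h : ∀ μ, f (w μ) = g (w μ)) : f = g := by
  have : f.comp mk = g.comp mk := MvPolynomial.algHom_ext h
  ext a
  obtain ⟨a, rfl⟩ := mk_surjective a
  exact DFunLike.congr_fun this a

theorem qmul_norm {A : Type*} [CommRing A] (a b : Fin 4 → A)
    (ha : a 0 ^ 2 + a 1 ^ 2 + a 2 ^ 2 + a 3 ^ 2 = 1)
    (hb : b 0 ^ 2 + b 1 ^ 2 + b 2 ^ 2 + b 3 ^ 2 = 1) :
    qmul a b 0 ^ 2 + qmul a b 1 ^ 2 + qmul a b 2 ^ 2 + qmul a b 3 ^ 2 = 1 := by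
  have : qmul a b 0 ^ 2 + qmul a b 1 ^ 2 + qmul a b 2 ^ 2 + qmul a b 3 ^ 2 =
      (a 0 ^ 2 + a 1 ^ 2 + a 2 ^ 2 + a 3 ^ 2) * (b 0 ^ 2 + b 1 ^ 2 + b 2 ^ 2 + b 3 ^ 2) := by
    simp [qmul]; ring
  rw [this, ha, hb, one_mul]

theorem left_norm : (w 0 ⊗ₜ[ℂ] (1 : CoordSU2)) ^ 2 + (w 1 ⊗ₜ[ℂ] (1 : CoordSU2)) ^ 2 +
    (w 2 ⊗ₜ[ℂ] (1 : CoordSU2)) ^ 2 + (w 3 ⊗ₜ[ℂ] (1 : CoordSU2)) ^ 2 = 1 := by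
  simp only [Algebra.TensorProduct.tmul_pow, one_pow, ← TensorProduct.add_tmul, w_rel]
  rfl

theorem right_norm : ((1 : CoordSU2) ⊗ₜ[ℂ] w 0) ^ 2 + ((1 : CoordSU2) ⊗ₜ[ℂ] w 1) ^ 2 +
    ((1 : CoordSU2) ⊗ₜ[ℂ] w 2) ^ 2 + ((1 : CoordSU2) ⊗ₜ[ℂ] w 3) ^ 2 = 1 := by
  simp only [Algebra.TensorProduct.tmul_pow, one_pow, ← TensorProduct.tmul_add, w_rel]
  rfl

/-- The coproduct, dual to the product of quaternions: `Δ w = w ⊗ w`. -/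
def comulHom : CoordSU2 →ₐ[ℂ] CoordSU2 ⊗[ℂ] CoordSU2 :=
  lift (qmul (fun μ => w μ ⊗ₜ 1) (fun μ => 1 ⊗ₜ w μ)) (qmul_norm _ _ left_norm right_norm)

/-- The evaluation of functions at a unit quaternion. -/
def eval (u : unitary ℍ[ℝ]) : CoordSU2 →ₐ[ℂ] ℂ :=
  lift (fun μ => ((qcoord u μ : ℝ) : ℂ)) (by
    have h : Quaternion.normSq (u : ℍ[ℝ]) = 1 := by
      have := Unitary.star_mul_self_of_mem u.2
      rw [Quaternion.star_mul_self] at this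
      exact Quaternion.coe_injective this
    rw [Quaternion.normSq_def'] at h
    simp only [qcoord, Matrix.cons_val]
    exact_mod_cast h)

/-- The counit: evaluation at the unit of the group. -/
def counitHom : CoordSU2 →ₐ[ℂ] ℂ := eval 1

/-- The antipode, dual to the inverse of unit quaternions. -/
def antipodeHom : CoordSU2 →ₐ[ℂ] CoordSU2 :=
  lift ![w 0, -w 1, -w 2, -w 3] (by simpa using w_rel)

theorem comulHom_w (μ : Fin 4) :
    comulHom (w μ) = qmul (fun μ => w μ ⊗ₜ[ℂ] (1 : CoordSU2)) (fun μ => 1 ⊗ₜ w μ) μ :=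
  lift_w _ _ _

theorem counitHom_w (μ : Fin 4) : counitHom (w μ) = ![1, 0, 0, 0] μ := by
  unfold counitHom eval
  rw [lift_w]
  fin_cases μ <;> simp [qcoord]

theorem antipodeHom_w (μ : Fin 4) : antipodeHom (w μ) = ![w 0, -w 1, -w 2, -w 3] μ :=
  lift_w _ _ _

instance : Bialgebra ℂ CoordSU2 := Bialgebra.ofAlgHom comulHom counitHom
  (by
    apply hom_ext
    intro μ
    fin_cases μ <;>
      simp [comulHom_w, qmul, TensorProduct.add_tmul, TensorProduct.sub_tmul,
        TensorProduct.tmul_add, TensorProduct.tmul_sub] <;> abel)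
  (by
    apply hom_ext
    intro μ
    fin_cases μ <;> simp [comulHom_w, counitHom_w, qmul])
  (by
    apply hom_ext
    intro μ
    fin_cases μ <;> simp [comulHom_w, counitHom_w, qmul])

theorem comulAlgHom_w (μ : Fin 4) : Bialgebra.comulAlgHom ℂ CoordSU2 (w μ) =
    qmul (fun μ => w μ ⊗ₜ[ℂ] (1 : CoordSU2)) (fun μ => 1 ⊗ₜ w μ) μ :=
  comulHom_w μ

theorem counitAlgHom_w (μ : Fin 4) :
    Bialgebra.counitAlgHom ℂ CoordSU2 (w μ) = ![1, 0, 0, 0] μ :=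
  counitHom_w μ

instance : HopfAlgebra ℂ CoordSU2 := HopfAlgebra.ofAlgHom antipodeHom
  (by
    apply hom_ext
    intro μ
    have h := w_rel
    have key : ∀ a b : CoordSU2, Algebra.TensorProduct.lift antipodeHom (.id ℂ CoordSU2)
        (fun _ => Commute.all _) (a ⊗ₜ[ℂ] b) = antipodeHom a * b := fun a b =>
      Algebra.TensorProduct.lift_tmul _ _ _ a b
    rw [AlgHom.comp_apply, AlgHom.comp_apply, comulAlgHom_w, counitAlgHom_w]
    fin_cases μ <;> simp [key, antipodeHom_w, qmul] <;> first | linear_combination h | ring)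
  (by
    apply hom_ext
    intro μ
    have h := w_rel
    have key : ∀ a b : CoordSU2, Algebra.TensorProduct.lift (.id ℂ CoordSU2) antipodeHom
        (fun _ _ => Commute.all _ _) (a ⊗ₜ[ℂ] b) = a * antipodeHom b := fun a b =>
      Algebra.TensorProduct.lift_tmul _ _ _ a b
    rw [AlgHom.comp_apply, AlgHom.comp_apply, comulAlgHom_w, counitAlgHom_w]
    fin_cases μ <;> simp [key, antipodeHom_w, qmul] <;> first | linear_combination h | ring)

/-- The star: complex conjugation of functions on `SU(2)`, so that the `w^μ` are hermitian. -/
def starHom : CoordSU2 →+* CoordSU2 :=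
  Ideal.Quotient.lift su2Ideal
    (MvPolynomial.eval₂Hom ((algebraMap ℂ CoordSU2).comp (starRingEnd ℂ)) w) (by
    intro a ha
    have : su2Ideal ≤ RingHom.ker
        (MvPolynomial.eval₂Hom ((algebraMap ℂ CoordSU2).comp (starRingEnd ℂ)) w) := by
      rw [su2Ideal, Ideal.span_le, Set.singleton_subset_iff]
      simp [RingHom.mem_ker, Fin.sum_univ_four, w_rel]
    exact this ha)

theorem starHom_w (μ : Fin 4) : starHom (w μ) = w μ :=
  MvPolynomial.eval₂_X _ _ _

theorem starHom_algebraMap (c : ℂ) :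
    starHom (algebraMap ℂ _ c) = algebraMap ℂ _ (conj c) :=
  MvPolynomial.eval₂_C _ _ _

theorem starHom_starHom (a : CoordSU2) : starHom (starHom a) = a := by
  obtain ⟨a, rfl⟩ := mk_surjective a
  induction a using MvPolynomial.induction_on with
  | C c =>
    have h : mk (MvPolynomial.C c) = algebraMap ℂ _ c := mk.commutes c
    rw [h, starHom_algebraMap, starHom_algebraMap, Complex.conj_conj]
  | add a b ha hb => rw [map_add, map_add, map_add, ha, hb]
  | mul_X a μ ha =>
    have h : starHom (mk (MvPolynomial.X μ)) = mk (MvPolynomial.X μ) := starHom_w μ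
    rw [map_mul, map_mul, map_mul, ha, h, h]

instance : StarRing CoordSU2 where
  star := starHom
  star_involutive := starHom_starHom
  star_mul a b := by rw [mul_comm a b]; exact map_mul starHom b a
  star_add := map_add starHom

instance : StarModule ℂ CoordSU2 where
  star_smul c a := by
    rw [Algebra.smul_def, Algebra.smul_def]
    exact (map_mul starHom _ _).trans (congrArg (· * starHom a) (starHom_algebraMap c))

end CoordSU2

/-! ### Noncommutative principal bundles -/

section HopfGalois

variable {P H : Type*} [Ring P] [Algebra ℂ P] [Ring H] [HopfAlgebra ℂ H]

/-- `δ : P → P ⊗ H` makes the algebra `P` a right `H`-comodule algebra. -/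
structure IsCoaction (δ : P →ₐ[ℂ] P ⊗[ℂ] H) : Prop where
  coassoc : ((Algebra.TensorProduct.assoc ℂ ℂ ℂ P H H).toAlgHom.comp
      (Algebra.TensorProduct.map δ (AlgHom.id ℂ H))).comp δ =
    (Algebra.TensorProduct.map (AlgHom.id ℂ P) (Bialgebra.comulAlgHom ℂ H)).comp δ
  counit : ((Algebra.TensorProduct.rid ℂ ℂ P).toAlgHom.comp
      (Algebra.TensorProduct.map (AlgHom.id ℂ P) (Bialgebra.counitAlgHom ℂ H))).comp δ =
    AlgHom.id ℂ P

/-- The subalgebra of right coinvariant elements, `δ p = p ⊗ 1`. -/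
def coinvariants (δ : P →ₐ[ℂ] P ⊗[ℂ] H) : Subalgebra ℂ P :=
  AlgHom.equalizer δ Algebra.TensorProduct.includeLeft

/-- The relations `p' b ⊗ p = p' ⊗ b p` for `b ∈ B`. -/
def balancing (B : Subalgebra ℂ P) : Submodule ℂ (P ⊗[ℂ] P) :=
  Submodule.span ℂ {t | ∃ p' p : P, ∃ b ∈ B, t = (p' * b) ⊗ₜ[ℂ] p - p' ⊗ₜ[ℂ] (b * p)}

/-- The tensor product `P ⊗_B P` over a (noncommutative) subalgebra `B`. -/
abbrev BalancedTensor (B : Subalgebra ℂ P) : Type _ := (P ⊗[ℂ] P) ⧸ balancing B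

/-- The lift `p' ⊗ p ↦ (p' ⊗ 1) δ(p)` of the canonical map to `P ⊗ P`. -/
def preCanonical (δ : P →ₐ[ℂ] P ⊗[ℂ] H) : P ⊗[ℂ] P →ₗ[ℂ] P ⊗[ℂ] H :=
  LinearMap.mul' ℂ (P ⊗[ℂ] H) ∘ₗ
    TensorProduct.map
      (Algebra.TensorProduct.includeLeft : P →ₐ[ℂ] P ⊗[ℂ] H).toLinearMap δ.toLinearMap

/-- The canonical map `χ : P ⊗_B P → P ⊗ H`, `χ(p' ⊗ p) = p' δ(p)`. -/
def canonicalMap (δ : P →ₐ[ℂ] P ⊗[ℂ] H) (B : Subalgebra ℂ P) (hB : B ≤ coinvariants δ) :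
    BalancedTensor B →ₗ[ℂ] P ⊗[ℂ] H :=
  (balancing B).liftQ (preCanonical δ) (by
    rw [balancing, Submodule.span_le]
    rintro _ ⟨p', p, b, hb, rfl⟩
    have h : δ b = b ⊗ₜ[ℂ] (1 : H) := hB hb
    simp only [SetLike.mem_coe, LinearMap.mem_ker, map_sub, sub_eq_zero, preCanonical,
      LinearMap.comp_apply, TensorProduct.map_tmul, LinearMap.mul'_apply, AlgHom.toLinearMap_apply,
      map_mul, h, Algebra.TensorProduct.includeLeft_apply, mul_assoc])

/-- `B ⊆ P` is a Hopf–Galois extension for the coaction `δ`: `B` is the algebra of coinvariants and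
the canonical map is bijective. -/
def IsHopfGalois (δ : P →ₐ[ℂ] P ⊗[ℂ] H) (B : Subalgebra ℂ P) : Prop :=
  ∃ h : B = coinvariants δ, Function.Bijective (canonicalMap δ B h.le)

end HopfGalois

end QuaternionicSphere

end

noncomputable section

namespace QuaternionicSphere

/-! ### Exchange frames -/

/-! Let E_μ be right multiplication by e_μ on ℍ = ℝ⁴, and let y be the 8 × 4 matrix over A = 𝒜(S⁷_R)
whose column μ holds the components of x₁e_μ and x₂e_μ. Column 0 consists of the generators, and
δ(x_I) = ∑ y_{Iν} ⊗ w^ν. The sphere relation gives yᵀy = 1, and B = 𝒜(S⁴_R) is generated by the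
entries of yyᵀ. Everything rests on an exchange law y_{Iμ}y_{Jν} = ∑ c_{KL} y_{Kν}y_{Lμ} with c
independent of the columns (`sphereFrame_isExchangeFrame`).

The mixed part of this law holds once R commutes with every E_μ ⊗ E_ν. The automorphisms give only
diagonal symmetry: since the ordered words x₂x₁ are linearly independent, R commutes with E_k ⊗ 1 +
1 ⊗ E_k (`slice_equivariant`). Yang–Baxter closes the gap. It makes the slices of R commute with one
another, and with the reality condition also with their conjugates. Their real and imaginary parts
therefore span a commutative space of real matrices, stable under commutators with the E_k. Such a
space commutes with every E_k, because ℍ has no nilpotents (`commute_unitMat_of_commutative`). So R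
commutes with 1 ⊗ E_k, hence also with E_k ⊗ 1.

The rest is formal in y. Swapping two factors permutes columns, which the commuting w^ν absorb, so δ
is well defined. Surjectivity of χ: 1 ⊗ w^μ = ∑ (y_{Kμ} ⊗ 1) δ(y_{K0}). Injectivity: the operators
T_μ(a ⊗ c) = ∑ a y_{Kμ} ⊗ y_{K0} c are well defined on A ⊗_B A, commute, and have squares summing to
1. Hence 𝒜(SU(2)) acts, and a ⊗ h ↦ a · h(1 ⊗ 1) is a left inverse of χ. Coinvariants: averaging the
second leg of δ fixes them. Moments of S³ are Gaussian moments rescaled by degree, and Gaussian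
integration by parts contracts letters in pairs to entries of yyᵀ, so the average lies in B. -/

open scoped IsMulCommutative in
/-- Pairwise commuting elements of an algebra define a map from a polynomial algebra. -/
theorem exists_algHom_of_commute {σ A : Type*} [Ring A] [Algebra ℂ A] (f : σ → A)
    (hf : ∀ i j, f i * f j = f j * f i) :
    ∃ φ : MvPolynomial σ ℂ →ₐ[ℂ] A, ∀ i, φ (MvPolynomial.X i) = f i := by
  have hcomm : ∀ a ∈ Set.range f, ∀ b ∈ Set.range f, a * b = b * a := by
    rintro _ ⟨i, rfl⟩ _ ⟨j, rfl⟩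
    exact hf i j
  have := Algebra.isMulCommutative_adjoin ℂ hcomm
  refine ⟨(Algebra.adjoin ℂ (Set.range f)).val.comp (MvPolynomial.aeval (R := ℂ)
    (fun i => (⟨f i, Algebra.subset_adjoin ⟨i, rfl⟩⟩ : Algebra.adjoin ℂ (Set.range f)))), ?_⟩
  intro i
  rw [AlgHom.comp_apply, MvPolynomial.aeval_X]
  rfl

section

variable {ι A : Type*} [Fintype ι] [Ring A] [Algebra ℂ A]

/-- A matrix with orthonormal columns over a noncommutative algebra, whose entries in two columns
can be exchanged in a way that does not depend on the columns. -/
structure IsExchangeFrame (y : ι → Fin 4 → A) : Prop where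
  exchange : ∀ I J, ∃ c : ι → ι → ℂ, ∀ μ ν,
    y I μ * y J ν = ∑ K, ∑ L, c K L • (y K ν * y L μ)
  orth : ∀ μ ν, ∑ I, y I μ * y I ν = if μ = ν then 1 else 0

/-- The entries of the projection `y yᵀ`. -/
def frameProj (y : ι → Fin 4 → A) (I J : ι) : A := ∑ μ, y I μ * y J μ

/-- The algebra generated by the entries of the projection `y yᵀ`. -/
def frameBase (y : ι → Fin 4 → A) : Subalgebra ℂ A :=
  Algebra.adjoin ℂ {z | ∃ I J, z = frameProj y I J}

omit [Fintype ι] in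
theorem frameProj_mem (y : ι → Fin 4 → A) (I J : ι) : frameProj y I J ∈ frameBase y :=
  Algebra.subset_adjoin ⟨I, J, rfl⟩

namespace IsExchangeFrame

variable {y : ι → Fin 4 → A} (hy : IsExchangeFrame y)
include hy

/-- Two exchanges carry y_{Iμ} to the right and leave both factors of column ν on the left. The
coefficients are the same for every ν, so the sum over ν rebuilds entries of yyᵀ; they are also the
same for every μ. -/
theorem mul_frameProj (I J K : ι) : ∃ d : ι → A, (∀ L, d L ∈ frameBase y) ∧
    ∀ μ, y I μ * frameProj y J K = ∑ L, d L * y L μ := by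
  obtain ⟨c, hc⟩ := hy.exchange I J
  choose c' hc' using fun L => hy.exchange L K
  refine ⟨fun M => ∑ S, ∑ L, ∑ T, (c S L * c' L T M) • frameProj y S T, fun M =>
    Subalgebra.sum_mem _ fun S _ => Subalgebra.sum_mem _ fun L _ => Subalgebra.sum_mem _ fun T _ =>
      Subalgebra.smul_mem _ (frameProj_mem y S T) _, fun μ => ?_⟩
  have h : ∀ ν, y I μ * (y J ν * y K ν) =
      ∑ M, ∑ S, ∑ L, ∑ T, (c S L * c' L T M) • (y S ν * y T ν * y M μ) := by
    intro ν
    rw [← mul_assoc, hc, Finset.sum_mul]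
    simp_rw [Finset.sum_mul, smul_mul_assoc, mul_assoc, hc', Finset.mul_sum, Finset.smul_sum,
      mul_smul_comm, smul_smul]
    calc _ = ∑ S, ∑ L, ∑ M, ∑ T, (c S L * c' L T M) • (y S ν * (y T ν * y M μ)) :=
          Finset.sum_congr rfl fun S _ => Finset.sum_congr rfl fun L _ => Finset.sum_comm
      _ = ∑ S, ∑ M, ∑ L, ∑ T, (c S L * c' L T M) • (y S ν * (y T ν * y M μ)) :=
          Finset.sum_congr rfl fun S _ => Finset.sum_comm
      _ = _ := Finset.sum_comm
  simp_rw [frameProj, Finset.mul_sum, h, Finset.sum_mul, smul_mul_assoc, Finset.sum_mul,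
    Finset.smul_sum]
  rw [Finset.sum_comm]
  refine Finset.sum_congr rfl fun M _ => ?_
  rw [Finset.sum_comm]
  refine Finset.sum_congr rfl fun S _ => ?_
  rw [Finset.sum_comm]
  refine Finset.sum_congr rfl fun L _ => ?_
  rw [Finset.sum_comm]

theorem mul_base {b : A} (hb : b ∈ frameBase y) (I : ι) : ∃ d : ι → A,
    (∀ L, d L ∈ frameBase y) ∧ ∀ μ, y I μ * b = ∑ L, d L * y L μ := by
  classical
  induction hb using Algebra.adjoin_induction generalizing I with
  | mem b hb =>
    obtain ⟨J, K, rfl⟩ := hb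
    exact hy.mul_frameProj I J K
  | algebraMap r =>
    refine ⟨fun L => if L = I then algebraMap ℂ A r else 0, fun L => ?_, fun μ => ?_⟩
    · dsimp only
      split_ifs
      · exact Subalgebra.algebraMap_mem _ r
      · exact Subalgebra.zero_mem _
    · simp [Algebra.commutes r (y I μ)]
  | add b b' _ _ h h' =>
    obtain ⟨d, hd, e⟩ := h I
    obtain ⟨d', hd', e'⟩ := h' I
    refine ⟨fun L => d L + d' L, fun L => Subalgebra.add_mem _ (hd L) (hd' L), fun μ => ?_⟩
    simp only [mul_add, e, e', add_mul, Finset.sum_add_distrib]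
  | mul b b' _ _ h h' =>
    obtain ⟨d, hd, e⟩ := h I
    choose d' hd' e' using h'
    refine ⟨fun M => ∑ L, d L * d' L M, fun M => Subalgebra.sum_mem _ fun L _ =>
      Subalgebra.mul_mem _ (hd L) (hd' L M), fun μ => ?_⟩
    rw [← mul_assoc, e]
    simp_rw [Finset.sum_mul, mul_assoc, e', Finset.mul_sum]
    exact Finset.sum_comm

/-- Moving b to the left of its row leaves entries of yyᵀ. This is what makes the operators `trans`
descend to A ⊗_B A. -/
theorem sandwich_mem {b : A} (hb : b ∈ frameBase y) (I J : ι) :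
    ∑ ν, y I ν * b * y J ν ∈ frameBase y := by
  obtain ⟨d, hd, e⟩ := hy.mul_base hb I
  have : ∑ ν, y I ν * b * y J ν = ∑ L, d L * frameProj y L J := by
    simp_rw [e, frameProj, Finset.mul_sum, Finset.sum_mul, mul_assoc]
    exact Finset.sum_comm
  rw [this]
  exact Subalgebra.sum_mem _ fun L _ => Subalgebra.mul_mem _ (hd L) (frameProj_mem y L J)

end IsExchangeFrame

/-! ### The balanced tensor product -/

/-- The class of `a ⊗ c` in `A ⊗_B A`. -/
def btmul (B : Subalgebra ℂ A) (a c : A) : BalancedTensor B := (balancing B).mkQ (a ⊗ₜ c)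

omit [Fintype ι] in
theorem btmul_balanced (B : Subalgebra ℂ A) (a c : A) {b : A} (hb : b ∈ B) :
    btmul B (a * b) c = btmul B a (b * c) := by
  rw [btmul, btmul, ← sub_eq_zero, ← map_sub, Submodule.mkQ_apply, Submodule.Quotient.mk_eq_zero]
  exact Submodule.subset_span ⟨a, c, b, hb, rfl⟩

theorem btmul_sum_left (B : Subalgebra ℂ A) {κ : Type*} (s : Finset κ) (a : κ → A) (c : A) :
    btmul B (∑ i ∈ s, a i) c = ∑ i ∈ s, btmul B (a i) c := by
  simp only [btmul, TensorProduct.sum_tmul, map_sum]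

theorem btmul_sum_right (B : Subalgebra ℂ A) {κ : Type*} (s : Finset κ) (a : A) (c : κ → A) :
    btmul B a (∑ i ∈ s, c i) = ∑ i ∈ s, btmul B a (c i) := by
  simp only [btmul, TensorProduct.tmul_sum, map_sum]

theorem btmul_smul_left (B : Subalgebra ℂ A) (r : ℂ) (a c : A) :
    btmul B (r • a) c = r • btmul B a c := by
  simp only [btmul, ← TensorProduct.smul_tmul', map_smul]

theorem btmul_smul_right (B : Subalgebra ℂ A) (r : ℂ) (a c : A) :
    btmul B a (r • c) = r • btmul B a c := by
  simp only [btmul, TensorProduct.tmul_smul, map_smul]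

theorem balanced_hom_ext {B : Subalgebra ℂ A} {X : Type*} [AddCommGroup X] [Module ℂ X]
    {f g : BalancedTensor B →ₗ[ℂ] X} (h : ∀ a c, f (btmul B a c) = g (btmul B a c)) : f = g := by
  refine Submodule.linearMap_qext _ (TensorProduct.ext' fun a c => ?_)
  exact h a c

/-- Left multiplication on `A ⊗_B A`. -/
def leftMul (B : Subalgebra ℂ A) (a : A) : Module.End ℂ (BalancedTensor B) :=
  (balancing B).mapQ (balancing B) (LinearMap.rTensor A (LinearMap.mulLeft ℂ a)) (by
    rw [balancing, Submodule.span_le]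
    rintro _ ⟨p', p, b, hb, rfl⟩
    refine Submodule.subset_span ⟨a * p', p, b, hb, ?_⟩
    simp [mul_assoc])

theorem leftMul_btmul (B : Subalgebra ℂ A) (a b c : A) :
    leftMul B a (btmul B b c) = btmul B (a * b) c := rfl

/-- The left `A`-module structure of `A ⊗_B A`. -/
def leftMulHom (B : Subalgebra ℂ A) : A →ₐ[ℂ] Module.End ℂ (BalancedTensor B) :=
  AlgHom.ofLinearMap
    { toFun := leftMul B
      map_add' := fun a a' => balanced_hom_ext fun b c => by
        rw [LinearMap.add_apply, leftMul_btmul, leftMul_btmul, leftMul_btmul, btmul, add_mul,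
          TensorProduct.add_tmul, map_add]
        rfl
      map_smul' := fun r a => balanced_hom_ext fun b c => by
        simp [leftMul_btmul, btmul_smul_left] }
    (balanced_hom_ext fun b c => by simp [leftMul_btmul])
    (fun a a' => balanced_hom_ext fun b c => by simp [leftMul_btmul, mul_assoc])

theorem leftMulHom_btmul (B : Subalgebra ℂ A) (a b c : A) :
    leftMulHom B a (btmul B b c) = btmul B (a * b) c := rfl

/-! ### Translation operators on A ⊗_B A -/

/-- The endomorphism `a ⊗ c ↦ ∑ a y_μ ⊗ y_0 c` of `A ⊗ A`. -/
def preTrans (y : ι → Fin 4 → A) (μ : Fin 4) : A ⊗[ℂ] A →ₗ[ℂ] A ⊗[ℂ] A :=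
  ∑ K, TensorProduct.map (LinearMap.mulRight ℂ (y K μ)) (LinearMap.mulLeft ℂ (y K 0))

theorem mkQ_preTrans (y : ι → Fin 4 → A) (μ : Fin 4) (a c : A) :
    (balancing (frameBase y)).mkQ (preTrans y μ (a ⊗ₜ c)) =
      ∑ K, btmul (frameBase y) (a * y K μ) (y K 0 * c) := by
  simp [preTrans, btmul]

namespace IsExchangeFrame

variable {y : ι → Fin 4 → A} (hy : IsExchangeFrame y)

section
include hy

theorem expand (K : ι) : y K 0 = ∑ M, ∑ ν, y K ν * (y M ν * y M 0) := by
  rw [Finset.sum_comm]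
  simp_rw [← Finset.mul_sum, hy.orth]
  simp

/-- By yᵀy = 1, y_{K0}b = ∑_M (∑_ν y_{Kν} b y_{Mν}) y_{M0}. The bracket lies in B and crosses the
tensor sign, where the sum over K collapses by yᵀy = 1 to b y_{Mμ}. -/
theorem trans_balanced (μ : Fin 4) (a c : A) {b : A} (hb : b ∈ frameBase y) :
    ∑ K, btmul (frameBase y) (a * b * y K μ) (y K 0 * c) =
      ∑ K, btmul (frameBase y) (a * y K μ) (y K 0 * (b * c)) := by
  have key : ∀ K, btmul (frameBase y) (a * y K μ) (y K 0 * (b * c)) =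
      ∑ M, btmul (frameBase y) (a * y K μ * ∑ ν, y K ν * b * y M ν) (y M 0 * c) := by
    intro K
    have h : y K 0 * (b * c) = ∑ M, (∑ ν, y K ν * b * y M ν) * (y M 0 * c) := by
      simp_rw [Finset.sum_mul]
      rw [Finset.sum_comm]
      simp_rw [mul_assoc, ← Finset.mul_sum]
      simp_rw [← mul_assoc, ← Finset.sum_mul, hy.orth]
      simp
    rw [h, btmul_sum_right]
    exact Finset.sum_congr rfl fun M _ => (btmul_balanced _ _ _ (hy.sandwich_mem hb K M)).symm
  simp_rw [key]
  rw [Finset.sum_comm]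
  refine Finset.sum_congr rfl fun M _ => ?_
  rw [← btmul_sum_left]
  congr 1
  simp_rw [Finset.mul_sum]
  rw [Finset.sum_comm]
  have h : ∀ ν, ∑ K, a * y K μ * (y K ν * b * y M ν) =
      a * (∑ K, y K μ * y K ν) * (b * y M ν) := by
    intro ν
    simp_rw [Finset.mul_sum, Finset.sum_mul, mul_assoc]
  simp_rw [h, hy.orth]
  simp [mul_assoc]

end

/-- The endomorphism `a ⊗ c ↦ ∑ a y_μ ⊗ y_0 c` of `A ⊗_B A`. -/
def trans (μ : Fin 4) : Module.End ℂ (BalancedTensor (frameBase y)) :=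
  (balancing (frameBase y)).mapQ (balancing (frameBase y)) (preTrans y μ) (by
    conv_lhs => rw [balancing]
    rw [Submodule.span_le]
    rintro _ ⟨p', p, b, hb, rfl⟩
    rw [SetLike.mem_coe, Submodule.mem_comap, ← Submodule.Quotient.mk_eq_zero,
      ← Submodule.mkQ_apply, map_sub, map_sub, mkQ_preTrans, mkQ_preTrans, sub_eq_zero]
    exact hy.trans_balanced μ p' p hb)

theorem trans_btmul (μ : Fin 4) (a c : A) : hy.trans μ (btmul (frameBase y) a c) =
    ∑ K, btmul (frameBase y) (a * y K μ) (y K 0 * c) :=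
  mkQ_preTrans y μ a c

theorem trans_leftMulHom (μ : Fin 4) (a : A) (m : BalancedTensor (frameBase y)) :
    hy.trans μ (leftMulHom _ a m) = leftMulHom _ a (hy.trans μ m) := by
  have : hy.trans μ ∘ₗ leftMulHom (frameBase y) a = leftMulHom (frameBase y) a ∘ₗ hy.trans μ :=
    balanced_hom_ext fun b c => by
      simp only [LinearMap.comp_apply, leftMulHom_btmul, trans_btmul, map_sum, mul_assoc]
  exact DFunLike.congr_fun this m

/-- Since y = (yyᵀ)y, the entries of yyᵀ in y_{K0} can cross to the left leg. A generator on the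
right leg thus becomes left multiplications and translations. -/
theorem btmul_gen_mul (K : ι) (a c : A) : btmul (frameBase y) a (y K 0 * c) =
    ∑ ν, leftMulHom _ (a * y K ν) (hy.trans ν (btmul (frameBase y) 1 c)) := by
  have h : y K 0 * c = ∑ M, frameProj y K M * (y M 0 * c) := by
    conv_lhs => rw [hy.expand K]
    simp_rw [frameProj, Finset.sum_mul, mul_assoc]
  rw [h, btmul_sum_right]
  simp_rw [← btmul_balanced _ _ _ (frameProj_mem y K _), frameProj, trans_btmul, map_sum,
    leftMulHom_btmul, one_mul, Finset.mul_sum, btmul_sum_left, mul_assoc]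
  exact Finset.sum_comm

end IsExchangeFrame

end

/-! ### The action of 𝒜(SU(2)) and bijectivity of the canonical map -/

section

variable {ι A : Type*} [Fintype ι] [Ring A] [Algebra ℂ A]

namespace IsExchangeFrame

variable {y : ι → Fin 4 → A} (hy : IsExchangeFrame y)

theorem btmul_gen_gen_mul (I J : ι) (c : A) :
    btmul (frameBase y) 1 (y I 0 * y J 0 * c) = ∑ μ, ∑ ν, leftMulHom _ (y I μ * y J ν)
      (hy.trans μ (hy.trans ν (btmul (frameBase y) 1 c))) := by
  rw [mul_assoc, hy.btmul_gen_mul]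
  refine Finset.sum_congr rfl fun μ _ => ?_
  rw [hy.btmul_gen_mul, map_sum, map_sum]
  refine Finset.sum_congr rfl fun ν _ => ?_
  rw [trans_leftMulHom, one_mul, one_mul, map_mul, Module.End.mul_apply]

-- Coefficients of words in two letters are unique. The multipliers come in reversed order so that
-- the sum over I collapses in the middle first, then the sum over J.
include hy in
theorem recover (v : Fin 4 → Fin 4 → BalancedTensor (frameBase y)) (μ ν : Fin 4) :
    ∑ I, ∑ J, leftMulHom _ (y J ν * y I μ) (∑ κ, ∑ τ, leftMulHom _ (y I κ * y J τ) (v κ τ)) =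
      v μ ν := by
  have h : ∀ κ τ, ∑ I, ∑ J, y J ν * y I μ * (y I κ * y J τ) =
      if μ = κ then (if ν = τ then 1 else 0) else 0 := by
    intro κ τ
    rw [Finset.sum_comm]
    have : ∀ J, ∑ I, y J ν * y I μ * (y I κ * y J τ) =
        y J ν * (∑ I, y I μ * y I κ) * y J τ := by
      intro J
      simp_rw [Finset.mul_sum, Finset.sum_mul, mul_assoc]
    simp_rw [this, hy.orth]
    split_ifs with h <;> simp [hy.orth, *]
  calc _ = ∑ κ, ∑ τ, leftMulHom _ (∑ I, ∑ J, y J ν * y I μ * (y I κ * y J τ)) (v κ τ) := by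
        simp_rw [map_sum, LinearMap.sum_apply, ← Module.End.mul_apply, ← map_mul]
        calc _ = ∑ I, ∑ κ, ∑ J, ∑ τ, leftMulHom _ (y J ν * y I μ * (y I κ * y J τ)) (v κ τ) :=
              Finset.sum_congr rfl fun I _ => Finset.sum_comm
          _ = ∑ κ, ∑ I, ∑ J, ∑ τ, leftMulHom _ (y J ν * y I μ * (y I κ * y J τ)) (v κ τ) :=
              Finset.sum_comm
          _ = ∑ κ, ∑ I, ∑ τ, ∑ J, leftMulHom _ (y J ν * y I μ * (y I κ * y J τ)) (v κ τ) :=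
              Finset.sum_congr rfl fun κ _ => Finset.sum_congr rfl fun I _ => Finset.sum_comm
          _ = _ := Finset.sum_congr rfl fun κ _ => Finset.sum_comm
    _ = v μ ν := by
        simp_rw [h]
        rw [Finset.sum_eq_single μ, Finset.sum_eq_single ν]
        · simp
        · intro τ _ hτ
          simp [Ne.symm hτ]
        · simp
        · intro κ _ hκ
          simp [Ne.symm hκ]
        · simp

/-- Expand 1 ⊗ y_{I0}y_{J0}c directly, and again after an exchange in column 0. Undoing the exchange
on the left leg swaps the columns, hence the order of the two operators; `recover` then strips the
coefficients. -/
theorem trans_comm (μ ν : Fin 4) : hy.trans μ * hy.trans ν = hy.trans ν * hy.trans μ := by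
  refine balanced_hom_ext fun a c => ?_
  have hac : btmul (frameBase y) a c = leftMulHom _ a (btmul (frameBase y) 1 c) := by
    rw [leftMulHom_btmul, mul_one]
  rw [hac]
  simp only [Module.End.mul_apply, trans_leftMulHom]
  congr 1
  have h : ∀ I J, ∑ κ, ∑ τ, leftMulHom _ (y I κ * y J τ)
      (hy.trans κ (hy.trans τ (btmul (frameBase y) 1 c))) =
      ∑ κ, ∑ τ, leftMulHom _ (y I κ * y J τ)
      (hy.trans τ (hy.trans κ (btmul (frameBase y) 1 c))) := by
    intro I J
    obtain ⟨d, hd⟩ := hy.exchange I J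
    rw [← hy.btmul_gen_gen_mul, hd 0 0]
    simp_rw [Finset.sum_mul, btmul_sum_right, smul_mul_assoc, btmul_smul_right,
      hy.btmul_gen_gen_mul]
    conv_rhs => rw [Finset.sum_comm]
    simp_rw [hd, map_sum, LinearMap.sum_apply, map_smul, LinearMap.smul_apply, Finset.smul_sum]
    calc _ = ∑ K, ∑ κ, ∑ L, ∑ τ, d K L • leftMulHom _ (y K κ * y L τ)
          (hy.trans κ (hy.trans τ (btmul (frameBase y) 1 c))) :=
          Finset.sum_congr rfl fun K _ => Finset.sum_comm
      _ = ∑ κ, ∑ K, ∑ L, ∑ τ, d K L • leftMulHom _ (y K κ * y L τ)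
          (hy.trans κ (hy.trans τ (btmul (frameBase y) 1 c))) := Finset.sum_comm
      _ = ∑ κ, ∑ K, ∑ τ, ∑ L, d K L • leftMulHom _ (y K κ * y L τ)
          (hy.trans κ (hy.trans τ (btmul (frameBase y) 1 c))) :=
          Finset.sum_congr rfl fun κ _ => Finset.sum_congr rfl fun K _ => Finset.sum_comm
      _ = _ := Finset.sum_congr rfl fun κ _ => Finset.sum_comm
  rw [← hy.recover (fun κ τ => hy.trans κ (hy.trans τ (btmul (frameBase y) 1 c))) μ ν,
    ← hy.recover (fun κ τ => hy.trans τ (hy.trans κ (btmul (frameBase y) 1 c))) μ ν]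
  simp_rw [h]

/-- Insert 1 = ∑ y_{I0}y_{I0} on the right leg and expand: the left coefficients sum to yᵀy = 1. -/
theorem trans_sq : ∑ μ, hy.trans μ ^ 2 = 1 := by
  refine balanced_hom_ext fun a c => ?_
  have hac : btmul (frameBase y) a c = leftMulHom _ a (btmul (frameBase y) 1 c) := by
    rw [leftMulHom_btmul, mul_one]
  rw [hac]
  simp only [LinearMap.sum_apply, sq, Module.End.mul_apply, trans_leftMulHom, ← map_sum,
    Module.End.one_apply]
  congr 1
  have h : btmul (frameBase y) 1 c = ∑ I, btmul (frameBase y) 1 (y I 0 * y I 0 * c) := by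
    rw [← btmul_sum_right, ← Finset.sum_mul, hy.orth]
    simp
  conv_rhs => rw [h]
  simp_rw [hy.btmul_gen_gen_mul]
  rw [Finset.sum_comm]
  refine Finset.sum_congr rfl fun μ _ => ?_
  rw [Finset.sum_comm]
  simp_rw [← LinearMap.sum_apply, ← map_sum, hy.orth]
  rw [Finset.sum_eq_single μ]
  · simp
  · intro ν _ hν
    simp [Ne.symm hν]
  · simp

/-- The operators `trans` assemble to an action of `𝒜(SU(2))` on `A ⊗_B A`. -/
theorem exists_action : ∃ Θ : CoordSU2 →ₐ[ℂ] Module.End ℂ (BalancedTensor (frameBase y)),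
    ∀ μ, Θ (CoordSU2.w μ) = hy.trans μ := by
  obtain ⟨φ, hφ⟩ := exists_algHom_of_commute hy.trans hy.trans_comm
  refine ⟨Ideal.Quotient.liftₐ su2Ideal φ ?_, ?_⟩
  · intro a ha
    have : su2Ideal ≤ RingHom.ker φ := by
      rw [su2Ideal, Ideal.span_le, Set.singleton_subset_iff]
      simp only [SetLike.mem_coe, RingHom.mem_ker, map_sub, map_sum, map_pow, map_one, hφ,
        hy.trans_sq, sub_self]
    exact this ha
  · intro μ
    rw [← hφ μ]
    rfl

variable {δ : A →ₐ[ℂ] A ⊗[ℂ] CoordSU2}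
  (hδ : ∀ I, δ (y I 0) = ∑ ν, y I ν ⊗ₜ CoordSU2.w ν)
  (hgen : Algebra.adjoin ℂ (Set.range fun I => y I 0) = ⊤)
  (hB : frameBase y ≤ coinvariants δ)

-- The left inverse is a ⊗ h ↦ a · Θ(h)(1 ⊗ 1), with Θ the action of 𝒜(SU(2)); left multiplications
-- commute with Θ.
include hy hδ hgen in
theorem canonicalMap_injective : Function.Injective (canonicalMap δ (frameBase y) hB) := by
  obtain ⟨Θ, hΘ⟩ := hy.exists_action
  have hcomm : ∀ a h, Commute (leftMulHom (frameBase y) a) (Θ h) := by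
    intro a h
    obtain ⟨h, rfl⟩ := CoordSU2.mk_surjective h
    induction h using MvPolynomial.induction_on with
    | C r =>
      rw [show CoordSU2.mk (MvPolynomial.C r) = algebraMap ℂ _ r from CoordSU2.mk.commutes r,
        AlgHom.commutes]
      exact (Algebra.commutes r _).symm
    | add p q hp hq => rw [map_add, map_add]; exact hp.add_right hq
    | mul_X p μ hp =>
      rw [map_mul, map_mul]
      refine hp.mul_right ?_
      rw [show CoordSU2.mk (MvPolynomial.X μ) = CoordSU2.w μ from rfl, hΘ]
      exact LinearMap.ext fun m => (hy.trans_leftMulHom μ a m).symm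
  set Ψ : A ⊗[ℂ] CoordSU2 →ₐ[ℂ] Module.End ℂ (BalancedTensor (frameBase y)) :=
    Algebra.TensorProduct.lift (leftMulHom _) Θ hcomm with hΨ
  have hΨt : ∀ a h, Ψ (a ⊗ₜ h) = leftMulHom _ a * Θ h := fun a h =>
    Algebra.TensorProduct.lift_tmul _ _ hcomm a h
  -- Keeping c arbitrary is what lets the induction pass through products p q.
  have key : ∀ p c, Ψ (δ p) (btmul _ 1 c) = btmul _ 1 (p * c) := by
    intro p
    have hp : p ∈ Algebra.adjoin ℂ (Set.range fun I => y I 0) := by rw [hgen]; trivial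
    induction hp using Algebra.adjoin_induction with
    | mem p hp =>
      obtain ⟨I, rfl⟩ := hp
      intro c
      simp only [hδ, map_sum, hΨt, LinearMap.sum_apply, Module.End.mul_apply, hΘ]
      rw [hy.btmul_gen_mul]
      simp
    | algebraMap r =>
      intro c
      rw [AlgHom.commutes, AlgHom.commutes, Module.algebraMap_end_apply,
        ← Algebra.smul_def, btmul_smul_right]
    | add p q _ _ hp hq =>
      intro c
      simp only [map_add, LinearMap.add_apply, hp, hq, add_mul]
      simp only [btmul, TensorProduct.tmul_add, map_add]
    | mul p q _ _ hp hq =>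
      intro c
      rw [map_mul, map_mul, Module.End.mul_apply, hq, hp, mul_assoc]
  let T : A ⊗[ℂ] CoordSU2 →ₗ[ℂ] BalancedTensor (frameBase y) :=
    LinearMap.applyₗ (btmul _ 1 1) ∘ₗ Ψ.toLinearMap
  have hT : T ∘ₗ canonicalMap δ (frameBase y) hB = LinearMap.id := by
    refine balanced_hom_ext fun a c => ?_
    have h1 : canonicalMap δ (frameBase y) hB (btmul _ a c) = (a ⊗ₜ 1) * δ c := rfl
    rw [LinearMap.comp_apply, h1]
    change Ψ ((a ⊗ₜ 1) * δ c) (btmul _ 1 1) = btmul _ a c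
    rw [map_mul, Module.End.mul_apply, key, hΨt, map_one, mul_one, leftMulHom_btmul, mul_one,
      mul_one]
  exact Function.LeftInverse.injective (g := T) fun m => DFunLike.congr_fun hT m

-- It suffices that the range, which contains all a ⊗ 1, is stable under multiplication by 1 ⊗ w^μ.
include hy hδ in
theorem canonicalMap_surjective : Function.Surjective (canonicalMap δ (frameBase y) hB) := by
  set X := LinearMap.range (canonicalMap δ (frameBase y) hB) with hX
  have hmem : ∀ a c, (a ⊗ₜ 1) * δ c ∈ X := fun a c => ⟨btmul _ a c, rfl⟩
  have hw : ∀ h : CoordSU2, ∀ z ∈ X, ((1 : A) ⊗ₜ[ℂ] h) * z ∈ X := by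
    intro h
    obtain ⟨h, rfl⟩ := CoordSU2.mk_surjective h
    induction h using MvPolynomial.induction_on with
    | C r =>
      intro z hz
      rw [show CoordSU2.mk (MvPolynomial.C r) = algebraMap ℂ _ r from CoordSU2.mk.commutes r,
        Algebra.algebraMap_eq_smul_one, TensorProduct.tmul_smul, smul_mul_assoc,
        ← Algebra.TensorProduct.one_def, one_mul]
      exact X.smul_mem r hz
    | add p q hp hq =>
      intro z hz
      rw [map_add, TensorProduct.tmul_add, add_mul]
      exact X.add_mem (hp z hz) (hq z hz)
    | mul_X p μ hp =>
      intro z hz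
      rw [map_mul, ← one_mul (1 : A), ← Algebra.TensorProduct.tmul_mul_tmul, mul_assoc]
      refine hp _ ?_
      obtain ⟨m, rfl⟩ := hz
      obtain ⟨t, rfl⟩ := Submodule.mkQ_surjective _ m
      induction t using TensorProduct.induction_on with
      | zero => simp
      | add s t hs ht =>
        rw [map_add, map_add, mul_add]
        exact X.add_mem hs ht
      | tmul a c =>
        have h1 : canonicalMap δ (frameBase y) hB (btmul _ a c) = (a ⊗ₜ 1) * δ c := rfl
        -- The translation map at w^μ, read off from yᵀy = 1. As 1 ⊗ w^μ commutes with a ⊗ 1, it can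
        -- be inserted just before δ(c).
        have h2 : (1 : A) ⊗ₜ[ℂ] CoordSU2.w μ = ∑ K, (y K μ ⊗ₜ[ℂ] (1 : CoordSU2)) * δ (y K 0) := by
          simp_rw [hδ, Finset.mul_sum, Algebra.TensorProduct.tmul_mul_tmul, one_mul]
          rw [Finset.sum_comm]
          simp_rw [← TensorProduct.sum_tmul, hy.orth]
          rw [Finset.sum_eq_single μ]
          · simp
          · intro ν _ hν
            simp [Ne.symm hν]
          · simp
        change (1 : A) ⊗ₜ[ℂ] CoordSU2.w μ * canonicalMap δ (frameBase y) hB (btmul _ a c) ∈ X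
        have h3 : (1 : A) ⊗ₜ[ℂ] CoordSU2.w μ * (a ⊗ₜ[ℂ] (1 : CoordSU2)) =
            (a ⊗ₜ[ℂ] (1 : CoordSU2)) * ((1 : A) ⊗ₜ[ℂ] CoordSU2.w μ) := by
          simp
        rw [h1, ← mul_assoc, h3, mul_assoc, h2, Finset.sum_mul, Finset.mul_sum]
        refine X.sum_mem fun K _ => ?_
        have := hmem (a * y K μ) (y K 0 * c)
        rw [map_mul] at this
        simpa [← mul_assoc] using this
  rw [← LinearMap.range_eq_top, eq_top_iff]
  intro z _
  induction z using TensorProduct.induction_on with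
  | zero => exact X.zero_mem
  | add s t hs ht => exact X.add_mem (hs trivial) (ht trivial)
  | tmul a h =>
    have := hw h _ (hmem a 1)
    rw [map_one, mul_one, Algebra.TensorProduct.tmul_mul_tmul, one_mul, mul_one] at this
    exact this

end IsExchangeFrame

end

/-! ### Moments of the three-sphere -/

/-- The moments of the standard Gaussian distribution. -/
def gaussMoment : ℕ → ℂ
  | 0 => 1
  | 1 => 0
  | n + 2 => (n + 1) * gaussMoment n

/-- The radial normalisation of the moments of the three-sphere. -/
def radialFactor : ℕ → ℂ
  | 0 => 1
  -- Values at odd degrees do not matter: such a monomial has an odd exponent, so its Gaussian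
  -- moment is 0.
  | 1 => 1
  -- For a standard Gaussian vector g in ℝ⁴, E|g|^(n+2) = (n+4) E|g|^n.
  | n + 2 => radialFactor n / (n + 4)

theorem gaussMoment_succ (n : ℕ) : gaussMoment (n + 1) = n * gaussMoment (n - 1) := by
  cases n with
  | zero => simp [gaussMoment]
  | succ n => simp [gaussMoment]

/-- The functional on polynomials with moments `φ |s| ∏ gaussMoment (s i)`. -/
def moment (φ : ℕ → ℂ) : MvPolynomial (Fin 4) ℂ →ₗ[ℂ] ℂ :=
  (MvPolynomial.basisMonomials (Fin 4) ℂ).constr ℂ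
    fun s => φ s.degree * ∏ i, gaussMoment (s i)

theorem moment_monomial (φ : ℕ → ℂ) (s : Fin 4 →₀ ℕ) :
    moment φ (MvPolynomial.monomial s 1) = φ s.degree * ∏ i, gaussMoment (s i) := by
  have := (MvPolynomial.basisMonomials (Fin 4) ℂ).constr_basis ℂ
    (fun s => φ s.degree * ∏ i, gaussMoment (s i)) s
  simpa [moment] using this

theorem prod_gaussMoment_single_add (s : Fin 4 →₀ ℕ) (ν : Fin 4) (k : ℕ) :
    ∏ i, gaussMoment ((Finsupp.single ν k + s) i) =
      gaussMoment (k + s ν) * ∏ i ∈ Finset.univ.erase ν, gaussMoment (s i) := by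
  rw [← Finset.mul_prod_erase _ _ (Finset.mem_univ ν)]
  congr 1
  · simp
  · refine Finset.prod_congr rfl fun i hi => ?_
    rw [Finsupp.add_apply, Finsupp.single_eq_of_ne (Finset.ne_of_mem_erase hi), zero_add]

/-- Gaussian integration by parts; on monomials it is the recursion for the moments, and the
truncated exponent at 0 is multiplied by 0. -/
theorem gauss_X_mul (ν : Fin 4) (p : MvPolynomial (Fin 4) ℂ) :
    moment 1 (MvPolynomial.X ν * p) = moment 1 (MvPolynomial.pderiv ν p) := by
  have : moment 1 ∘ₗ LinearMap.mulLeft ℂ (MvPolynomial.X ν) =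
      moment 1 ∘ₗ (MvPolynomial.pderiv (R := ℂ) ν).toLinearMap := by
    refine (MvPolynomial.basisMonomials (Fin 4) ℂ).ext fun s => ?_
    have h0 : ∀ p, (MvPolynomial.pderiv (R := ℂ) ν).toLinearMap p = MvPolynomial.pderiv ν p :=
      fun _ => rfl
    simp only [MvPolynomial.coe_basisMonomials, LinearMap.comp_apply, LinearMap.mulLeft_apply,
      h0, MvPolynomial.pderiv_monomial, one_mul]
    have h1 : MvPolynomial.X ν * MvPolynomial.monomial s (1 : ℂ) =
        MvPolynomial.monomial (Finsupp.single ν 1 + s) 1 := by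
      rw [MvPolynomial.X, MvPolynomial.monomial_mul, one_mul]
    have h2 : MvPolynomial.monomial (s - Finsupp.single ν 1) ((s ν : ℕ) : ℂ) =
        (s ν : ℂ) • MvPolynomial.monomial (s - Finsupp.single ν 1) (1 : ℂ) := by
      rw [MvPolynomial.smul_monomial, smul_eq_mul, mul_one]
    rw [h1, h2, map_smul, moment_monomial, moment_monomial, prod_gaussMoment_single_add,
      add_comm 1, gaussMoment_succ]
    have h3 : ∏ i, gaussMoment ((s - Finsupp.single ν 1 : Fin 4 →₀ ℕ) i) =
        gaussMoment (s ν - 1) * ∏ i ∈ Finset.univ.erase ν, gaussMoment (s i) := by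
      rw [← Finset.mul_prod_erase _ _ (Finset.mem_univ ν)]
      congr 1
      · simp
      · refine Finset.prod_congr rfl fun i hi => ?_
        rw [Finsupp.tsub_apply, Finsupp.single_eq_of_ne (Finset.ne_of_mem_erase hi), tsub_zero]
    rw [h3]
    simp [mul_assoc]
  exact DFunLike.congr_fun this p

/-- On a monomial of degree d, the factor X_μ² multiplies the Gaussian moment by s_μ + 1. These sum
to d + 4, which the radial factor divides out. -/
theorem moment_sphere (p : MvPolynomial (Fin 4) ℂ) :
    moment radialFactor (p * (∑ μ, MvPolynomial.X μ ^ 2 - 1)) = 0 := by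
  have : moment radialFactor ∘ₗ LinearMap.mulRight ℂ (∑ μ, MvPolynomial.X μ ^ 2 - 1) = 0 := by
    refine (MvPolynomial.basisMonomials (Fin 4) ℂ).ext fun s => ?_
    simp only [MvPolynomial.coe_basisMonomials, LinearMap.comp_apply, LinearMap.mulRight_apply,
      LinearMap.zero_apply]
    have h1 : ∀ μ, MvPolynomial.monomial s (1 : ℂ) * MvPolynomial.X μ ^ 2 =
        MvPolynomial.monomial (Finsupp.single μ 2 + s) 1 := by
      intro μ
      rw [MvPolynomial.X_pow_eq_monomial, MvPolynomial.monomial_mul, one_mul, add_comm]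
    have h2 : ∀ μ, moment radialFactor (MvPolynomial.monomial (Finsupp.single μ 2 + s) 1) =
        (s μ + 1) * (radialFactor s.degree / (s.degree + 4) * ∏ i, gaussMoment (s i)) := by
      intro μ
      rw [moment_monomial, prod_gaussMoment_single_add, map_add, Finsupp.degree_single,
        add_comm 2, add_comm 2, gaussMoment, radialFactor,
        ← Finset.mul_prod_erase _ _ (Finset.mem_univ μ)]
      ring
    rw [mul_sub, Finset.mul_sum, mul_one, map_sub, map_sum]
    simp_rw [h1, h2]
    rw [← Finset.sum_mul, Finset.sum_add_distrib, moment_monomial]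
    have h3 : ∑ i, (s i : ℂ) = s.degree := by
      rw [Finsupp.degree_eq_sum, Nat.cast_sum]
    have h4 : (s.degree : ℂ) + 4 ≠ 0 := by
      have : ((s.degree + 4 : ℕ) : ℂ) ≠ 0 := Nat.cast_ne_zero.2 (by omega)
      simpa using this
    rw [h3]
    simp
    field_simp
    ring
  exact DFunLike.congr_fun this p

/-- The mean value over the group `SU(2)`. -/
def haar : CoordSU2 →ₗ[ℂ] ℂ :=
  (su2Ideal.restrictScalars ℂ).liftQ (moment radialFactor) (by
    intro p hp
    rw [Submodule.restrictScalars_mem, su2Ideal, Ideal.mem_span_singleton'] at hp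
    obtain ⟨q, rfl⟩ := hp
    exact moment_sphere q)

theorem haar_mk (p : MvPolynomial (Fin 4) ℂ) : haar (CoordSU2.mk p) = moment radialFactor p := rfl

theorem haar_one : haar 1 = 1 := by
  have h : (1 : CoordSU2) = CoordSU2.mk (MvPolynomial.monomial 0 1) := (map_one CoordSU2.mk).symm
  rw [h, haar_mk, moment_monomial]
  simp [gaussMoment, radialFactor]

/-! ### Averaging over SU(2) and the coinvariants -/

section

variable {ι A : Type*} [Fintype ι] [Ring A] [Algebra ℂ A]

/-- A functional on the second factor, applied to a tensor product. -/
def contract {V : Type*} [AddCommGroup V] [Module ℂ V] (f : V →ₗ[ℂ] ℂ) : A ⊗[ℂ] V →ₗ[ℂ] A :=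
  TensorProduct.rid ℂ A ∘ₗ LinearMap.lTensor A f

omit [Fintype ι] in
theorem contract_tmul {V : Type*} [AddCommGroup V] [Module ℂ V] (f : V →ₗ[ℂ] ℂ) (a : A) (v : V) :
    contract f (a ⊗ₜ[ℂ] v) = f v • a := by
  simp [contract]

omit [Fintype ι] in
theorem contract_tmul_one_mul {V : Type*} [Ring V] [Algebra ℂ V] (f : V →ₗ[ℂ] ℂ) (a : A)
    (t : A ⊗[ℂ] V) : contract f ((a ⊗ₜ 1) * t) = a * contract f t := by
  induction t using TensorProduct.induction_on with
  | zero => simp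
  | add s t hs ht => rw [mul_add, map_add, map_add, mul_add, hs, ht]
  | tmul b v => simp [contract_tmul]

/-- The generic vector `∑ y_ν ⊗ X_ν` of a frame. -/
def genericVec (y : ι → Fin 4 → A) (I : ι) : A ⊗[ℂ] MvPolynomial (Fin 4) ℂ :=
  ∑ ν, y I ν ⊗ₜ MvPolynomial.X ν

/-- Words in the generic vectors. -/
def genericWord (y : ι → Fin 4 → A) (l : List ι) : A ⊗[ℂ] MvPolynomial (Fin 4) ℂ :=
  (l.map (genericVec y)).prod

/-- The partial derivative on the second factor. -/
def tderiv (ν : Fin 4) :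
    A ⊗[ℂ] MvPolynomial (Fin 4) ℂ →ₗ[ℂ] A ⊗[ℂ] MvPolynomial (Fin 4) ℂ :=
  LinearMap.lTensor A (MvPolynomial.pderiv (R := ℂ) ν).toLinearMap

theorem tderiv_tmul (ν : Fin 4) (a : A) (p : MvPolynomial (Fin 4) ℂ) :
    tderiv ν (a ⊗ₜ[ℂ] p) = a ⊗ₜ MvPolynomial.pderiv ν p := rfl

theorem tderiv_mul (ν : Fin 4) (s t : A ⊗[ℂ] MvPolynomial (Fin 4) ℂ) :
    tderiv ν (s * t) = tderiv ν s * t + s * tderiv ν t := by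
  induction s using TensorProduct.induction_on with
  | zero => simp
  | add s s' hs hs' => rw [add_mul, map_add, hs, hs', map_add]; noncomm_ring
  | tmul a p =>
    induction t using TensorProduct.induction_on with
    | zero => simp
    | add t t' ht ht' => rw [mul_add, map_add, ht, ht', map_add]; noncomm_ring
    | tmul b q =>
      simp only [Algebra.TensorProduct.tmul_mul_tmul, tderiv_tmul, Derivation.leibniz, smul_eq_mul,
        TensorProduct.tmul_add, mul_comm q]
      exact add_comm _ _

omit [Fintype ι] in
theorem tderiv_genericVec (y : ι → Fin 4 → A) (ν : Fin 4) (I : ι) :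
    tderiv ν (genericVec y I) = y I ν ⊗ₜ 1 := by
  rw [genericVec, map_sum, Finset.sum_eq_single ν]
  · simp [tderiv_tmul]
  · intro μ _ hμ
    simp [tderiv_tmul, MvPolynomial.pderiv_X_of_ne hμ]
  · simp

theorem contract_gauss_X_mul (ν : Fin 4) (t : A ⊗[ℂ] MvPolynomial (Fin 4) ℂ) :
    contract (moment 1) ((1 ⊗ₜ MvPolynomial.X ν) * t) = contract (moment 1) (tderiv ν t) := by
  induction t using TensorProduct.induction_on with
  | zero => simp
  | add s t hs ht => rw [mul_add, map_add, map_add, map_add, hs, ht]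
  | tmul b q =>
    rw [Algebra.TensorProduct.tmul_mul_tmul, one_mul, tderiv_tmul, contract_tmul, contract_tmul,
      gauss_X_mul]

/-- The derivative along a row of a frame. -/
def rowDeriv (y : ι → Fin 4 → A) (I : ι) (t : A ⊗[ℂ] MvPolynomial (Fin 4) ℂ) :
    A ⊗[ℂ] MvPolynomial (Fin 4) ℂ :=
  ∑ ν, (y I ν ⊗ₜ 1) * tderiv ν t

-- Integration by parts on the second leg turns the leading letter into a derivation along its row.
omit [Fintype ι] in
theorem contract_genericVec_mul (y : ι → Fin 4 → A) (I : ι)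
    (t : A ⊗[ℂ] MvPolynomial (Fin 4) ℂ) :
    contract (moment 1) (genericVec y I * t) = contract (moment 1) (rowDeriv y I t) := by
  rw [genericVec, rowDeriv, Finset.sum_mul, map_sum, map_sum]
  refine Finset.sum_congr rfl fun ν _ => ?_
  have : y I ν ⊗ₜ[ℂ] MvPolynomial.X (R := ℂ) ν =
      (y I ν ⊗ₜ[ℂ] (1 : MvPolynomial (Fin 4) ℂ)) * ((1 : A) ⊗ₜ[ℂ] MvPolynomial.X ν) := by
    simp
  rw [this, mul_assoc, contract_tmul_one_mul, contract_tmul_one_mul, contract_gauss_X_mul]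

/-- The span of words of length less than `n`, with coefficients in the base algebra. -/
def shortSpan (y : ι → Fin 4 → A) (n : ℕ) : Submodule ℂ (A ⊗[ℂ] MvPolynomial (Fin 4) ℂ) :=
  Submodule.span ℂ {t | ∃ b ∈ frameBase y, ∃ l : List ι, l.length < n ∧
    t = (b ⊗ₜ 1) * genericWord y l}

namespace IsExchangeFrame

variable {y : ι → Fin 4 → A} (hy : IsExchangeFrame y)

section
include hy

theorem genericVec_mul_mem {n : ℕ} (J : ι) {t : A ⊗[ℂ] MvPolynomial (Fin 4) ℂ}
    (ht : t ∈ shortSpan y n) : genericVec y J * t ∈ shortSpan y (n + 1) := by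
  induction ht using Submodule.span_induction with
  | zero => rw [mul_zero]; exact Submodule.zero_mem _
  | add s t _ _ hs ht => rw [mul_add]; exact Submodule.add_mem _ hs ht
  | smul r t _ ht => rw [mul_smul_comm]; exact Submodule.smul_mem _ r ht
  | mem t ht =>
    obtain ⟨b, hb, l, hl, rfl⟩ := ht
    obtain ⟨d, hd, e⟩ := hy.mul_base hb J
    have : genericVec y J * ((b ⊗ₜ 1) * genericWord y l) =
        ∑ L, (d L ⊗ₜ 1) * genericWord y (L :: l) := by
      have h : genericVec y J * (b ⊗ₜ 1) = ∑ L, (d L ⊗ₜ 1) * genericVec y L := by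
        simp_rw [genericVec, Finset.sum_mul, Finset.mul_sum, Algebra.TensorProduct.tmul_mul_tmul,
          e, TensorProduct.sum_tmul, mul_one, one_mul]
        exact Finset.sum_comm
      rw [← mul_assoc, h, Finset.sum_mul]
      simp [genericWord, mul_assoc]
    rw [this]
    refine Submodule.sum_mem _ fun L _ => Submodule.subset_span ⟨d L, hd L, L :: l, ?_, rfl⟩
    simpa using hl

/-- This is Wick contraction. The derivative either hits the letter J and yields an entry of yyᵀ, or
passes it, and then y_{Iν} is exchanged past that letter with coefficients independent of ν. -/
theorem rowDeriv_genericWord (I : ι) (l : List ι) :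
    rowDeriv y I (genericWord y l) ∈ shortSpan y l.length := by
  induction l generalizing I with
  | nil =>
    have : ∀ ν, tderiv ν (1 : A ⊗[ℂ] MvPolynomial (Fin 4) ℂ) = 0 := by
      intro ν
      rw [Algebra.TensorProduct.one_def, tderiv_tmul, ← map_one MvPolynomial.C,
        MvPolynomial.pderiv_C, TensorProduct.tmul_zero]
    simp [rowDeriv, genericWord, this]
  | cons J l ih =>
    obtain ⟨c, hc⟩ := hy.exchange I J
    have hexch : ∀ ν, (y I ν ⊗ₜ[ℂ] (1 : MvPolynomial (Fin 4) ℂ)) * genericVec y J =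
        ∑ K, ∑ L, c K L • (genericVec y K * (y L ν ⊗ₜ[ℂ] (1 : MvPolynomial (Fin 4) ℂ))) := by
      intro ν
      simp_rw [genericVec, Finset.mul_sum, Finset.sum_mul, Algebra.TensorProduct.tmul_mul_tmul,
        hc, one_mul, mul_one, TensorProduct.sum_tmul, Finset.smul_sum, TensorProduct.smul_tmul']
      rw [Finset.sum_comm]
      exact Finset.sum_congr rfl fun K _ => Finset.sum_comm
    have hcons : genericWord y (J :: l) = genericVec y J * genericWord y l := by
      simp [genericWord]
    have key : rowDeriv y I (genericWord y (J :: l)) =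
        (frameProj y I J ⊗ₜ 1) * genericWord y l +
          ∑ K, ∑ L, c K L • (genericVec y K * rowDeriv y L (genericWord y l)) := by
      simp_rw [hcons, rowDeriv, tderiv_mul, mul_add, ← mul_assoc, tderiv_genericVec, hexch,
        Algebra.TensorProduct.tmul_mul_tmul, one_mul, Finset.sum_add_distrib, ← Finset.sum_mul,
        ← TensorProduct.sum_tmul, frameProj, Finset.mul_sum, Finset.sum_mul, Finset.smul_sum,
        smul_mul_assoc, mul_assoc]
      congr 1
      rw [Finset.sum_comm]
      exact Finset.sum_congr rfl fun K _ => Finset.sum_comm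
    rw [key]
    refine Submodule.add_mem _ (Submodule.subset_span ⟨_, frameProj_mem y I J, l, ?_, rfl⟩) ?_
    · simp
    · exact Submodule.sum_mem _ fun K _ => Submodule.sum_mem _ fun L _ =>
        Submodule.smul_mem _ _ (hy.genericVec_mul_mem K (ih L))

/-- Wick's theorem by induction on the length bound: coefficients in B come out on the left, and
contracting the leading letter shortens the word. -/
theorem contract_gauss_mem (n : ℕ) {t : A ⊗[ℂ] MvPolynomial (Fin 4) ℂ}
    (ht : t ∈ shortSpan y n) : contract (moment 1) t ∈ frameBase y := by
  induction n generalizing t with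
  | zero =>
    have : shortSpan y 0 = ⊥ := by
      rw [shortSpan, Submodule.span_eq_bot]
      rintro _ ⟨_, _, l, hl, _⟩
      exact absurd hl (Nat.not_lt_zero _)
    rw [this, Submodule.mem_bot] at ht
    rw [ht, map_zero]
    exact Subalgebra.zero_mem _
  | succ n ih =>
    induction ht using Submodule.span_induction with
    | zero => rw [map_zero]; exact Subalgebra.zero_mem _
    | add s t _ _ hs ht => rw [map_add]; exact Subalgebra.add_mem _ hs ht
    | smul r t _ ht => rw [map_smul]; exact Subalgebra.smul_mem _ ht r
    | mem t ht =>
      obtain ⟨b, hb, l, hl, rfl⟩ := ht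
      rw [contract_tmul_one_mul]
      refine Subalgebra.mul_mem _ hb ?_
      cases l with
      | nil =>
        rw [genericWord, List.map_nil, List.prod_nil, Algebra.TensorProduct.one_def, contract_tmul]
        exact Subalgebra.smul_mem _ (Subalgebra.one_mem _) _
      | cons J l =>
        have hcons : genericWord y (J :: l) = genericVec y J * genericWord y l := by
          simp [genericWord]
        rw [hcons, contract_genericVec_mul]
        refine ih (Submodule.span_mono ?_ (hy.rowDeriv_genericWord J l))
        rintro _ ⟨b, hb, l', hl', rfl⟩
        refine ⟨b, hb, l', ?_, rfl⟩
        simp only [List.length_cons] at hl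
        omega

end

omit [Fintype ι] in
theorem genericWord_mem_span (l : List ι) : genericWord y l ∈ Submodule.span ℂ
    {t | ∃ a : A, ∃ s : Fin 4 →₀ ℕ, s.degree = l.length ∧ t = a ⊗ₜ MvPolynomial.monomial s 1} := by
  induction l with
  | nil => exact Submodule.subset_span ⟨1, 0, by simp, rfl⟩
  | cons J l ih =>
    have hcons : genericWord y (J :: l) = genericVec y J * genericWord y l := by
      simp [genericWord]
    rw [hcons]
    generalize genericWord y l = t at ih ⊢
    induction ih using Submodule.span_induction with
    | zero => rw [mul_zero]; exact Submodule.zero_mem _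
    | add s t _ _ hs ht => rw [mul_add]; exact Submodule.add_mem _ hs ht
    | smul r t _ ht => rw [mul_smul_comm]; exact Submodule.smul_mem _ r ht
    | mem t ht =>
      obtain ⟨a, s, hs, rfl⟩ := ht
      rw [genericVec, Finset.sum_mul]
      refine Submodule.sum_mem _ fun ν _ => Submodule.subset_span
        ⟨y J ν * a, Finsupp.single ν 1 + s, ?_, ?_⟩
      · rw [map_add, Finsupp.degree_single, hs, List.length_cons, add_comm]
      · rw [Algebra.TensorProduct.tmul_mul_tmul, MvPolynomial.X, MvPolynomial.monomial_mul, one_mul]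

-- A word of length n is homogeneous of degree n in the X_ν, where the two functionals differ by the
-- scalar φ n. This reduces the sphere to the Gaussian case.
omit [Fintype ι] in
theorem contract_moment_genericWord (φ : ℕ → ℂ) (l : List ι) :
    contract (moment φ) (genericWord y l) =
      φ l.length • contract (moment 1) (genericWord y l) := by
  have := genericWord_mem_span (y := y) l
  generalize genericWord y l = t at this ⊢
  induction this using Submodule.span_induction with
  | zero => simp
  | add s t _ _ hs ht => rw [map_add, hs, ht, map_add, smul_add]
  | smul r t _ ht => rw [map_smul, ht, map_smul, smul_comm]
  | mem t ht =>
    obtain ⟨a, s, hs, rfl⟩ := ht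
    rw [contract_tmul, contract_tmul, moment_monomial, moment_monomial, hs, smul_smul]
    simp

include hy in
theorem contract_genericWord_mem (φ : ℕ → ℂ) (l : List ι) :
    contract (moment φ) (genericWord y l) ∈ frameBase y := by
  rw [contract_moment_genericWord]
  refine Subalgebra.smul_mem _ (hy.contract_gauss_mem (l.length + 1)
    (Submodule.subset_span ⟨1, Subalgebra.one_mem _, l, Nat.lt_succ_self _, ?_⟩)) _
  rw [← Algebra.TensorProduct.one_def, one_mul]

variable {δ : A →ₐ[ℂ] A ⊗[ℂ] CoordSU2}
  (hδ : ∀ I, δ (y I 0) = ∑ ν, y I ν ⊗ₜ CoordSU2.w ν)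
  (hgen : Algebra.adjoin ℂ (Set.range fun I => y I 0) = ⊤)

include hy hδ hgen in
theorem contract_haar_mem (a : A) : contract haar (δ a) ∈ frameBase y := by
  have ha : a ∈ Subalgebra.toSubmodule (Algebra.adjoin ℂ (Set.range fun I => y I 0)) := by
    rw [hgen]; trivial
  rw [Algebra.adjoin_eq_span] at ha
  induction ha using Submodule.span_induction with
  | zero => simp
  | add s t _ _ hs ht => rw [map_add, map_add]; exact Subalgebra.add_mem _ hs ht
  | smul r t _ ht => rw [map_smul, map_smul]; exact Subalgebra.smul_mem _ ht r
  | mem a ha =>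
    -- On words in the generators, δ is the reduction of a generic word modulo the sphere relation.
    have hl : ∃ l : List ι, δ a =
        Algebra.TensorProduct.map (AlgHom.id ℂ A) CoordSU2.mk (genericWord y l) := by
      induction ha using Submonoid.closure_induction with
      | mem a ha =>
        obtain ⟨I, rfl⟩ := ha
        refine ⟨[I], ?_⟩
        simp only [genericWord, genericVec, List.map_cons, List.map_nil, List.prod_singleton, hδ,
          map_sum, Algebra.TensorProduct.map_tmul]
        rfl
      | one => exact ⟨[], by simp [genericWord]⟩
      | mul a b _ _ ha hb =>
        obtain ⟨l, hl⟩ := ha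
        obtain ⟨l', hl'⟩ := hb
        exact ⟨l ++ l', by rw [map_mul, hl, hl', ← map_mul]; simp [genericWord]⟩
    obtain ⟨l, hl⟩ := hl
    have hc : ∀ t : A ⊗[ℂ] MvPolynomial (Fin 4) ℂ,
        contract haar (Algebra.TensorProduct.map (AlgHom.id ℂ A) CoordSU2.mk t) =
          contract (moment radialFactor) t := by
      intro t
      induction t using TensorProduct.induction_on with
      | zero => simp
      | add s t hs ht => rw [map_add, map_add, map_add, hs, ht]
      | tmul a p =>
        rw [Algebra.TensorProduct.map_tmul, contract_tmul, contract_tmul, haar_mk, AlgHom.id_apply]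
    rw [hl, hc]
    exact hy.contract_genericWord_mem _ l

-- Averaging fixes a coinvariant because the functional is normalised; its invariance plays no role.
include hy hδ hgen in
theorem coinvariants_le : coinvariants δ ≤ frameBase y := by
  intro a ha
  have h : δ a = a ⊗ₜ 1 := ha
  have := hy.contract_haar_mem hδ hgen a
  rwa [h, contract_tmul, haar_one, one_smul] at this

include hy hδ hgen in
/-- The frame algebra is a Hopf–Galois extension of its base. -/
theorem isHopfGalois (hB : frameBase y ≤ coinvariants δ) : IsHopfGalois δ (frameBase y) :=
  ⟨le_antisymm hB (hy.coinvariants_le hδ hgen), hy.canonicalMap_injective hδ hgen _,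
    hy.canonicalMap_surjective hδ _⟩

end IsExchangeFrame

end

/-! ### Right multiplication by the quaternion units -/

/-- The matrices of right multiplication by the quaternion units. -/
def rightMat : Fin 4 → Matrix (Fin 4) (Fin 4) ℤ :=
  ![1,
    !![0, -1, 0, 0; 1, 0, 0, 0; 0, 0, 0, 1; 0, 0, -1, 0],
    !![0, 0, -1, 0; 0, 0, 0, -1; 1, 0, 0, 0; 0, 1, 0, 0],
    !![0, 0, 0, -1; 0, 0, 1, 0; 0, -1, 0, 0; 1, 0, 0, 0]]

theorem qmul_eq_sum {A : Type*} [Ring A] (a b : Fin 4 → A) (i : Fin 4) :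
    qmul a b i = ∑ μ, ∑ k, rightMat μ i k • (a k * b μ) := by
  fin_cases i <;> simp [qmul, rightMat, Fin.sum_univ_four] <;> abel

/-- The matrices of right multiplication over a ring. -/
def unitMat (K : Type*) [Ring K] (μ : Fin 4) : Matrix (Fin 4) (Fin 4) K :=
  (rightMat μ).map (Int.cast : ℤ → K)

theorem unitMat_zero (K : Type*) [Ring K] : unitMat K 0 = 1 := by
  simp [unitMat, rightMat]

theorem unitMat_mul (K : Type*) [Ring K] (μ ν : Fin 4) :
    unitMat K μ * unitMat K ν = (rightMat μ * rightMat ν).map (Int.cast : ℤ → K) :=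
  (Matrix.map_mul (f := Int.castRingHom K)).symm

theorem unitMat_sq (K : Type*) [Ring K] {μ : Fin 4} (h : μ ≠ 0) :
    unitMat K μ * unitMat K μ = -1 := by
  have : rightMat μ * rightMat μ = -1 := by
    revert h; revert μ; decide
  rw [unitMat_mul, this]
  ext i j
  by_cases hij : i = j <;> simp [hij]

theorem unitMat_anticomm (K : Type*) [Ring K] {μ ν : Fin 4} (h : μ ≠ 0) (h' : ν ≠ 0)
    (hne : μ ≠ ν) : unitMat K ν * unitMat K μ = -(unitMat K μ * unitMat K ν) := by
  have : rightMat ν * rightMat μ = -(rightMat μ * rightMat ν) := by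
    revert h h' hne; revert μ ν; decide
  rw [unitMat_mul, unitMat_mul, this]
  ext i j
  simp

/-- The minus signs come from right multiplication reversing products: E₁E₂ is x ↦ x e₂e₁ = -x e₃.
-/
theorem unitMat_third (K : Type*) [Ring K] :
    unitMat K 1 * unitMat K 2 = -unitMat K 3 ∧ unitMat K 2 * unitMat K 3 = -unitMat K 1 ∧
      unitMat K 3 * unitMat K 1 = -unitMat K 2 := by
  have h : rightMat 1 * rightMat 2 = -rightMat 3 ∧ rightMat 2 * rightMat 3 = -rightMat 1 ∧
      rightMat 3 * rightMat 1 = -rightMat 2 := by decide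
  refine ⟨?_, ?_, ?_⟩ <;> rw [unitMat_mul] <;> simp only [h] <;> ext i j <;> simp [unitMat]

/-- The double commutator of an element with two anticommuting complex structures. -/
theorem double_commutator {T : Type*} [Ring T] {e f : T} (s : T) (he : e * e = -1)
    (hf : f * f = -1) (hef : f * e = -(e * f)) :
    ((s * e - e * s) * f - f * (s * e - e * s)) * e =
        e * ((s * e - e * s) * f - f * (s * e - e * s)) ∧
      ((s * e - e * s) * f - f * (s * e - e * s)) * f =
        -(f * ((s * e - e * s) * f - f * (s * e - e * s))) := by
  -- As e² = -1, a commutator with e anticommutes with e, and likewise for f. Both [s, e] and f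
  -- anticommute with e, so their products commute with it.
  have he' : ∀ x, e * (e * x) = -x := fun x => by rw [← mul_assoc, he, neg_one_mul]
  have hf' : ∀ x, f * (f * x) = -x := fun x => by rw [← mul_assoc, hf, neg_one_mul]
  have hef' : ∀ x, f * (e * x) = -(e * (f * x)) := fun x => by
    rw [← mul_assoc, hef, neg_mul, mul_assoc]
  constructor <;>
    simp only [sub_mul, mul_sub, mul_assoc, he, hf, hef, he', hf', hef', neg_mul, mul_neg, mul_one,
      neg_neg] <;> abel

/-- A matrix commuting with right multiplications is left multiplication by the quaternion in its
column 0, and ℍ has no nonzero nilpotents. The equations `e0` to `e3` say that this quaternion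
squares to 0. -/
theorem eq_zero_of_centralizes {z : Matrix (Fin 4) (Fin 4) ℝ}
    (hz : ∀ k, z * unitMat ℝ k = unitMat ℝ k * z) (h0 : z * z = 0) : z = 0 := by
  have h1 : ∀ i, z i 1 = (unitMat ℝ 1 * z) i 0 := fun i => by
    rw [← hz]; simp [Matrix.mul_apply, Fin.sum_univ_four, unitMat, rightMat]
  have h2 : ∀ i, z i 2 = (unitMat ℝ 2 * z) i 0 := fun i => by
    rw [← hz]; simp [Matrix.mul_apply, Fin.sum_univ_four, unitMat, rightMat]
  have h3 : ∀ i, z i 3 = (unitMat ℝ 3 * z) i 0 := fun i => by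
    rw [← hz]; simp [Matrix.mul_apply, Fin.sum_univ_four, unitMat, rightMat]
  have e : ∀ i, (z * z) i 0 = 0 := fun i => by rw [h0]; rfl
  have e0 := e 0
  have e1 := e 1
  have e2 := e 2
  have e3 := e 3
  simp only [Matrix.mul_apply, Fin.sum_univ_four, h1, h2, h3, unitMat, rightMat] at e0 e1 e2 e3
  simp at e0 e1 e2 e3
  have q1 : z 0 0 * z 1 0 = 0 := by linarith
  have q2 : z 0 0 * z 2 0 = 0 := by linarith
  have q3 : z 0 0 * z 3 0 = 0 := by linarith
  have r0 : z 0 0 = 0 := by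
    by_contra hne
    have k1 := (mul_eq_zero.1 q1).resolve_left hne
    have k2 := (mul_eq_zero.1 q2).resolve_left hne
    have k3 := (mul_eq_zero.1 q3).resolve_left hne
    simp [k1, k2, k3] at e0
    exact hne e0
  have r1 : z 1 0 = 0 := by
    nlinarith [mul_self_nonneg (z 1 0), mul_self_nonneg (z 2 0), mul_self_nonneg (z 3 0)]
  have r2 : z 2 0 = 0 := by
    nlinarith [mul_self_nonneg (z 1 0), mul_self_nonneg (z 2 0), mul_self_nonneg (z 3 0)]
  have r3 : z 3 0 = 0 := by
    nlinarith [mul_self_nonneg (z 1 0), mul_self_nonneg (z 2 0), mul_self_nonneg (z 3 0)]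
  have r : ∀ i, z i 0 = 0 := by
    intro i; fin_cases i <;> assumption
  ext i j
  have : ∀ k, (unitMat ℝ k * z) i 0 = 0 := fun k => by
    rw [Matrix.mul_apply]; exact Finset.sum_eq_zero fun l _ => by rw [r, mul_zero]
  fin_cases j
  · exact r i
  · exact (h1 i).trans (this 1)
  · exact (h2 i).trans (this 2)
  · exact (h3 i).trans (this 3)

theorem commute_unitMat_of_two {z : Matrix (Fin 4) (Fin 4) ℝ} {μ ν : Fin 4} (h : μ ≠ 0)
    (h' : ν ≠ 0) (hne : μ ≠ ν) (hμ : z * unitMat ℝ μ = unitMat ℝ μ * z)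
    (hν : z * unitMat ℝ ν = unitMat ℝ ν * z) (k : Fin 4) :
    z * unitMat ℝ k = unitMat ℝ k * z := by
  have hprod : z * (unitMat ℝ μ * unitMat ℝ ν) = unitMat ℝ μ * unitMat ℝ ν * z := by
    rw [← mul_assoc, hμ, mul_assoc, hν, mul_assoc]
  have hk : rightMat k = 1 ∨ k = μ ∨ k = ν ∨ rightMat k = rightMat μ * rightMat ν ∨
      rightMat k = -(rightMat μ * rightMat ν) := by
    clear hμ hν hprod
    revert h h' hne; revert μ ν k; decide
  rcases hk with hk | rfl | rfl | hk | hk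
  · simp [unitMat, hk]
  · exact hμ
  · exact hν
  · have : unitMat ℝ k = unitMat ℝ μ * unitMat ℝ ν := by rw [unitMat_mul, ← hk]; rfl
    rw [this, hprod]
  · have : unitMat ℝ k = -(unitMat ℝ μ * unitMat ℝ ν) := by
      rw [unitMat_mul, unitMat, hk]; ext; simp
    rw [this, mul_neg, neg_mul, hprod]

/-- A commutative space of real matrices that is stable under commutators with the right
multiplications consists of matrices that commute with the right multiplications. -/
theorem commute_unitMat_of_commutative {C : Submodule ℝ (Matrix (Fin 4) (Fin 4) ℝ)}
    (hC : ∀ s ∈ C, ∀ t ∈ C, s * t = t * s)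
    (hE : ∀ s ∈ C, ∀ k, s * unitMat ℝ k - unitMat ℝ k * s ∈ C) {s : Matrix (Fin 4) (Fin 4) ℝ}
    (hs : s ∈ C) (k : Fin 4) : s * unitMat ℝ k = unitMat ℝ k * s := by
  -- The double commutator t = [[s, e], f] vanishes. It lies in C, and so does [t, f] = 2tf; these
  -- commute while t anticommutes with f, which forces t² = 0.
  have key : ∀ μ ν : Fin 4, μ ≠ 0 → ν ≠ 0 → μ ≠ ν →
      (s * unitMat ℝ μ - unitMat ℝ μ * s) * unitMat ℝ ν =
        unitMat ℝ ν * (s * unitMat ℝ μ - unitMat ℝ μ * s) := by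
    intro μ ν hμ hν hne
    have he := unitMat_sq ℝ hμ
    have hf := unitMat_sq ℝ hν
    have hef := unitMat_anticomm ℝ hμ hν hne
    have htC := hE _ (hE s hs μ) ν
    obtain ⟨h1, h2⟩ := double_commutator s he hf hef
    set t := (s * unitMat ℝ μ - unitMat ℝ μ * s) * unitMat ℝ ν -
      unitMat ℝ ν * (s * unitMat ℝ μ - unitMat ℝ μ * s) with ht
    set e := unitMat ℝ μ
    set f := unitMat ℝ ν
    have h3 := hC t htC _ (hE t htC ν)
    have hft : f * t = -(t * f) := by rw [h2, neg_neg]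
    have h4 : t * f - f * t = (2 : ℝ) • (t * f) := by rw [hft, sub_neg_eq_add, two_smul]
    have h5 : t * (t * f) = t * f * t := by
      change t * (t * f - f * t) = (t * f - f * t) * t at h3
      rw [h4, mul_smul_comm, smul_mul_assoc] at h3
      exact smul_right_injective _ (two_ne_zero) h3
    have h6 : t * t * f = 0 := by
      have h7 : t * f * t = -(t * t * f) := by rw [mul_assoc, hft, mul_neg, mul_assoc]
      rw [← mul_assoc, h7] at h5
      have h9 : (2 : ℝ) • (t * t * f) = 0 := by
        rw [two_smul]; nth_rewrite 1 [h5]; exact neg_add_cancel _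
      exact (smul_eq_zero.1 h9).resolve_left two_ne_zero
    have h8 : t * t = 0 := by
      have : t * t * f * f = 0 := by rw [h6, zero_mul]
      rwa [mul_assoc, hf, mul_neg, mul_one, neg_eq_zero] at this
    have hz : t * e = 0 := by
      -- Unlike t, the product t e commutes with both e and f, hence with all units, and (te)² = -t²
      -- = 0.
      refine eq_zero_of_centralizes (commute_unitMat_of_two hμ hν hne ?_ ?_) ?_
      · rw [← mul_assoc, ← h1]
      · change t * e * f = f * (t * e)
        rw [← mul_assoc, hft, mul_assoc, neg_mul, mul_assoc t f e, hef, mul_neg, neg_neg]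
      · rw [mul_assoc, ← mul_assoc e, ← h1, mul_assoc, he, mul_neg, mul_neg, mul_one, h8, neg_zero]
    have ht0 : t = 0 := by
      have : t * e * e = 0 := by rw [hz, zero_mul]
      rwa [mul_assoc, he, mul_neg, mul_one, neg_eq_zero] at this
    exact sub_eq_zero.1 ht0
  -- Jacobi: [[s, e], f] - [[s, f], e] = [s, [e, f]] = 2[s, ef], and both double commutators vanish.
  have jac : ∀ μ ν : Fin 4, μ ≠ 0 → ν ≠ 0 → μ ≠ ν →
      s * (unitMat ℝ μ * unitMat ℝ ν) = unitMat ℝ μ * unitMat ℝ ν * s := by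
    intro μ ν hμ hν hne
    have k1 := key μ ν hμ hν hne
    have k2 := key ν μ hν hμ hne.symm
    have hef := unitMat_anticomm ℝ hμ hν hne
    set e := unitMat ℝ μ
    set f := unitMat ℝ ν
    have h : (2 : ℝ) • (s * (e * f) - e * f * s) = 0 := by
      have : (2 : ℝ) • (s * (e * f) - e * f * s) =
          (s * (e * f) - e * f * s) - (s * -(e * f) - -(e * f) * s) := by
        rw [two_smul, mul_neg, neg_mul]; abel
      rw [this, ← hef]
      calc _ = ((s * e - e * s) * f - f * (s * e - e * s)) -
            ((s * f - f * s) * e - e * (s * f - f * s)) := by noncomm_ring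
        _ = 0 := by rw [k1, k2]; simp
    exact sub_eq_zero.1 ((smul_eq_zero.1 h).resolve_left two_ne_zero)
  obtain ⟨h3, h1, h2⟩ := unitMat_third ℝ
  fin_cases k
  · simp [unitMat_zero]
  · have := jac 2 3 (by decide) (by decide) (by decide)
    rw [h1] at this
    simpa using this
  · have := jac 3 1 (by decide) (by decide) (by decide)
    rw [h2] at this
    simpa using this
  · have := jac 1 2 (by decide) (by decide) (by decide)
    rw [h3] at this
    simpa using this

/-! ### The Yang–Baxter equation in components -/

section YangBaxter

variable (R : DefMatrix) {κ : Type*} (X : Matrix (Idx × Idx × Idx) κ ℂ) (n : κ)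

theorem leg₁₂_inl_inl (l l' : Fin 4) (c : Idx) :
    (leg₁₂ (bigR R) * X) (Sum.inl l, Sum.inl l', c) n = X (Sum.inl l', Sum.inl l, c) n := by
  simp [Matrix.mul_apply, Fintype.sum_prod_type, leg₁₂, bigR, ite_and]

theorem leg₁₂_inr_inr (l l' : Fin 4) (c : Idx) :
    (leg₁₂ (bigR R) * X) (Sum.inr l, Sum.inr l', c) n = X (Sum.inr l', Sum.inr l, c) n := by
  simp [Matrix.mul_apply, Fintype.sum_prod_type, leg₁₂, bigR, ite_and]

theorem leg₁₂_inl_inr (l a : Fin 4) (c : Idx) :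
    (leg₁₂ (bigR R) * X) (Sum.inl l, Sum.inr a, c) n =
      ∑ b, ∑ m, R l a b m * X (Sum.inr b, Sum.inl m, c) n := by
  simp [Matrix.mul_apply, Fintype.sum_prod_type, leg₁₂, bigR]

theorem leg₂₃_inl_inl (l l' : Fin 4) (c : Idx) :
    (leg₂₃ (bigR R) * X) (c, Sum.inl l, Sum.inl l') n = X (c, Sum.inl l', Sum.inl l) n := by
  simp [Matrix.mul_apply, Fintype.sum_prod_type, leg₂₃, bigR, ite_and]

theorem leg₂₃_inr_inr (l l' : Fin 4) (c : Idx) :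
    (leg₂₃ (bigR R) * X) (c, Sum.inr l, Sum.inr l') n = X (c, Sum.inr l', Sum.inr l) n := by
  simp [Matrix.mul_apply, Fintype.sum_prod_type, leg₂₃, bigR, ite_and]

theorem leg₂₃_inl_inr (l a : Fin 4) (c : Idx) :
    (leg₂₃ (bigR R) * X) (c, Sum.inl l, Sum.inr a) n =
      ∑ b, ∑ m, R l a b m * X (c, Sum.inr b, Sum.inl m) n := by
  simp [Matrix.mul_apply, Fintype.sum_prod_type, leg₂₃, bigR]

end YangBaxter

theorem yangBaxter_mul_one {R : DefMatrix} (hR : IsDeformation R) :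
    leg₁₂ (bigR R) * (leg₂₃ (bigR R) * (leg₁₂ (bigR R) * 1)) =
      leg₂₃ (bigR R) * (leg₁₂ (bigR R) * (leg₂₃ (bigR R) * 1)) := by
  rw [mul_one, mul_one, ← mul_assoc, ← mul_assoc]
  exact hR.yangBaxter

/-- The x₁x₁x₂ component of Yang–Baxter: commutation of the matrices (R l · · m). -/
theorem yangBaxter_inl_inl_inr {R : DefMatrix} (hR : IsDeformation R) (l l' a b m m' : Fin 4) :
    ∑ k, R l a k m * R l' k b m' = ∑ k, R l' a k m' * R l k b m := by
  have h := congrFun (congrFun (yangBaxter_mul_one hR) (Sum.inl l, Sum.inl l', Sum.inr a))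
    (Sum.inr b, Sum.inl m', Sum.inl m)
  rw [leg₁₂_inl_inl, leg₂₃_inl_inr, leg₂₃_inl_inr] at h
  simp only [leg₁₂_inl_inr, leg₂₃_inl_inl] at h
  simpa [Matrix.one_apply, ite_and, Finset.mul_sum] using h

/-- The x₁x₂x₂ component of Yang–Baxter: commutation of the matrices (R · a b ·). -/
theorem yangBaxter_inl_inr_inr {R : DefMatrix} (hR : IsDeformation R) (l a a' b b' m : Fin 4) :
    ∑ k, R l a b k * R k a' b' m = ∑ k, R l a' b' k * R k a b m := by
  have h := congrFun (congrFun (yangBaxter_mul_one hR) (Sum.inl l, Sum.inr a, Sum.inr a'))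
    (Sum.inr b', Sum.inr b, Sum.inl m)
  rw [leg₁₂_inl_inr, leg₂₃_inr_inr, leg₁₂_inl_inr] at h
  simp only [leg₂₃_inl_inr, leg₁₂_inr_inr] at h
  simpa [Matrix.one_apply, ite_and, Finset.mul_sum] using h

/-- The matrices `(R l · · m)`. -/
def slice (R : DefMatrix) (l m : Fin 4) : Matrix (Fin 4) (Fin 4) ℂ := fun a b => R l a b m

theorem slice_comm {R : DefMatrix} (hR : IsDeformation R) (l l' m m' : Fin 4) :
    slice R l m * slice R l' m' = slice R l' m' * slice R l m := by
  ext a b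
  simp only [Matrix.mul_apply, slice]
  exact yangBaxter_inl_inl_inr hR l l' a b m m'

/-- By reality, the block matrix S' of conjugate slices is the inverse of the block matrix S of
slices. A slice repeated along the diagonal commutes with S, hence with its inverse. -/
theorem slice_conj_comm {R : DefMatrix} (hR : IsDeformation R) (l l' m m' : Fin 4) :
    (slice R l m).map conj * slice R l' m' = slice R l' m' * (slice R l m).map conj := by
  let S : Matrix (Fin 4) (Fin 4) (Matrix (Fin 4) (Fin 4) ℂ) := Matrix.of (slice R)
  let S' : Matrix (Fin 4) (Fin 4) (Matrix (Fin 4) (Fin 4) ℂ) :=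
    Matrix.of fun l m => (slice R l m).map conj
  let D : Matrix (Fin 4) (Fin 4) (Matrix (Fin 4) (Fin 4) ℂ) :=
    Matrix.diagonal fun _ => slice R l' m'
  have h1 : S' * S = 1 := by
    ext l n a c
    have := hR.real l a c n
    rw [Finset.sum_comm] at this
    simp only [Matrix.mul_apply, S, S', Matrix.of_apply, slice, Matrix.sum_apply, Matrix.map_apply]
    rw [this]
    by_cases hln : l = n <;> by_cases hac : a = c <;> simp [hln, hac, Matrix.one_apply]
  have h2 : S * S' = 1 := by
    ext l n a c
    have := congrArg conj (hR.real l a c n)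
    rw [Finset.sum_comm] at this
    simp only [map_sum, map_mul, Complex.conj_conj] at this
    simp only [Matrix.mul_apply, S, S', Matrix.of_apply, slice, Matrix.sum_apply, Matrix.map_apply]
    rw [this]
    by_cases hln : l = n <;> by_cases hac : a = c <;> simp [hln, hac, Matrix.one_apply]
  have hD : D * S = S * D := by
    refine Matrix.ext fun l m => ?_
    rw [Matrix.diagonal_mul, Matrix.mul_diagonal]
    exact slice_comm hR _ _ _ _
  have hD' : D * S' = S' * D := by
    calc D * S' = S' * S * D * S' := by rw [h1, one_mul]
      _ = S' * (D * S) * S' := by rw [hD, mul_assoc S']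
      _ = S' * D * (S * S') := by simp only [mul_assoc]
      _ = S' * D := by rw [h2, mul_one]
  have := congrFun (congrFun hD' l) m
  rw [Matrix.diagonal_mul, Matrix.mul_diagonal] at this
  exact this.symm

/-- The real and imaginary parts of the slices. -/
def slicePart (R : DefMatrix) (l m : Fin 4) : Fin 2 → Matrix (Fin 4) (Fin 4) ℝ :=
  ![(slice R l m).map Complex.re, (slice R l m).map Complex.im]

/-- Real matrices are required later because the complexified quaternions do contain nilpotents.
Commutation with the conjugate slices is what allows the passage to real and imaginary parts. -/
theorem slicePart_comm {R : DefMatrix} (hR : IsDeformation R) (l l' m m' : Fin 4) (i j : Fin 2) :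
    slicePart R l m i * slicePart R l' m' j = slicePart R l' m' j * slicePart R l m i := by
  have h1 : ∀ a b, ∑ k, R l a k m * R l' k b m' = ∑ k, R l' a k m' * R l k b m :=
    fun a b => yangBaxter_inl_inl_inr hR l l' a b m m'
  have h2 : ∀ a b, ∑ k, conj (R l a k m) * R l' k b m' = ∑ k, R l' a k m' * conj (R l k b m) := by
    intro a b
    have := congrFun (congrFun (slice_conj_comm hR l l' m m') a) b
    simpa [Matrix.mul_apply, slice] using this
  have key : ∀ a b, (slicePart R l m i * slicePart R l' m' j) a b =
      (slicePart R l' m' j * slicePart R l m i) a b := by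
    intro a b
    have r1 := congrArg Complex.re (h1 a b)
    have r2 := congrArg Complex.re (h2 a b)
    have i1 := congrArg Complex.im (h1 a b)
    have i2 := congrArg Complex.im (h2 a b)
    simp only [Fin.sum_univ_four, Complex.add_re, Complex.add_im, Complex.mul_re, Complex.mul_im,
      Complex.conj_re, Complex.conj_im] at r1 r2 i1 i2
    fin_cases i <;> fin_cases j <;>
      simp [slicePart, slice, Matrix.mul_apply, Fin.sum_univ_four] <;> linarith
  ext a b
  exact key a b

/-- Infinitesimal equivariance has real coefficients, so it splits into parts. It makes the real
span of the parts stable under commutators with E_k. -/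
theorem slice_commutator {R : DefMatrix} (k : Fin 4)
    (h : ∀ l m, ∑ n, unitMat ℂ k l n • slice R n m + unitMat ℂ k * slice R l m =
      slice R l m * unitMat ℂ k + ∑ n, unitMat ℂ k n m • slice R l n) (l m : Fin 4) (i : Fin 2) :
    slicePart R l m i * unitMat ℝ k - unitMat ℝ k * slicePart R l m i =
      ∑ n, unitMat ℝ k l n • slicePart R n m i - ∑ n, unitMat ℝ k n m • slicePart R l n i := by
  have h' := h l m
  rw [← sub_eq_zero] at h'
  rw [← sub_eq_zero]
  ext a b
  have r := congrArg Complex.re (congrFun (congrFun h' a) b)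
  have s := congrArg Complex.im (congrFun (congrFun h' a) b)
  simp only [Matrix.add_apply, Matrix.sub_apply, Matrix.smul_apply,
    Matrix.mul_apply, Fin.sum_univ_four, unitMat, Matrix.map_apply, slice, smul_eq_mul,
    Complex.add_re, Complex.add_im, Complex.sub_re, Complex.sub_im, Complex.mul_re, Complex.mul_im,
    Complex.intCast_re, Complex.intCast_im, Matrix.zero_apply, Complex.zero_re,
    Complex.zero_im] at r s
  fin_cases i <;>
    simp [slicePart, slice, Matrix.mul_apply, Fin.sum_univ_four, unitMat] <;>
    linarith

/-- Diagonal symmetry splits: R commutes with 1 ⊗ E_k alone. -/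
theorem slice_unitMat {R : DefMatrix} (hR : IsDeformation R)
    (h : ∀ k l m, ∑ n, unitMat ℂ k l n • slice R n m + unitMat ℂ k * slice R l m =
      slice R l m * unitMat ℂ k + ∑ n, unitMat ℂ k n m • slice R l n) (k l m : Fin 4) :
    slice R l m * unitMat ℂ k = unitMat ℂ k * slice R l m := by
  let C : Submodule ℝ (Matrix (Fin 4) (Fin 4) ℝ) :=
    Submodule.span ℝ {s | ∃ l m i, s = slicePart R l m i}
  have hmem : ∀ l m i, slicePart R l m i ∈ C := fun l m i => Submodule.subset_span ⟨l, m, i, rfl⟩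
  have hC : ∀ s ∈ C, ∀ t ∈ C, s * t = t * s := by
    intro s hs t ht
    induction hs, ht using Submodule.span_induction₂ with
    | mem_mem s t hs ht =>
      obtain ⟨l, m, i, rfl⟩ := hs
      obtain ⟨l', m', j, rfl⟩ := ht
      exact slicePart_comm hR _ _ _ _ _ _
    | zero_left => simp
    | zero_right => simp
    | add_left s s' t _ _ _ h h' => rw [add_mul, mul_add, h, h']
    | add_right s s' t _ _ _ h h' => rw [add_mul, mul_add, h, h']
    | smul_left r s t _ _ h => rw [smul_mul_assoc, mul_smul_comm, h]
    | smul_right r s t _ _ h => rw [smul_mul_assoc, mul_smul_comm, h]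
  have hE : ∀ s ∈ C, ∀ k, s * unitMat ℝ k - unitMat ℝ k * s ∈ C := by
    intro s hs k
    induction hs using Submodule.span_induction with
    | zero => simp
    | add s t _ _ hs ht =>
      have : (s + t) * unitMat ℝ k - unitMat ℝ k * (s + t) =
        (s * unitMat ℝ k - unitMat ℝ k * s) + (t * unitMat ℝ k - unitMat ℝ k * t) := by
        noncomm_ring
      rw [this]
      exact C.add_mem hs ht
    | smul r s _ hs =>
      rw [smul_mul_assoc, mul_smul_comm, ← smul_sub]
      exact C.smul_mem r hs
    | mem s hs =>
      obtain ⟨l, m, i, rfl⟩ := hs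
      rw [slice_commutator k (h k)]
      exact C.sub_mem (C.sum_mem fun n _ => C.smul_mem _ (hmem _ _ _))
        (C.sum_mem fun n _ => C.smul_mem _ (hmem _ _ _))
  have key := fun i => commute_unitMat_of_commutative hC hE (hmem l m i) k
  ext a b
  have h0 := congrFun (congrFun (key 0) a) b
  have h1 := congrFun (congrFun (key 1) a) b
  simp only [slicePart, slice, Matrix.mul_apply, unitMat, Matrix.map_apply, Matrix.cons_val_zero,
    Matrix.cons_val_one] at h0 h1
  apply Complex.ext
  · simpa [slice, Matrix.mul_apply, unitMat] using h0
  · simpa [slice, Matrix.mul_apply, unitMat] using h1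

/-! ### Linear independence of ordered words -/

/-- The polynomials in the coordinates `x₂`. -/
abbrev Poly : Type := MvPolynomial (Fin 4) ℂ

/-- The matrices by which the coordinates `x₁` move past `x₂ᵃ`. -/
def passMat (R : DefMatrix) (a : Fin 4) : Matrix (Fin 4) (Fin 4) Poly :=
  Matrix.of fun l m => ∑ b, MvPolynomial.C (R l a b m) * MvPolynomial.X b

theorem passMat_comm {R : DefMatrix} (hR : IsDeformation R) (a a' : Fin 4) :
    passMat R a * passMat R a' = passMat R a' * passMat R a := by
  ext1 l m
  have h : ∀ a a', (passMat R a * passMat R a') l m = ∑ b, ∑ b',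
      MvPolynomial.C (∑ k, R l a b k * R k a' b' m) * (MvPolynomial.X b * MvPolynomial.X b') := by
    intro a a'
    simp_rw [Matrix.mul_apply, passMat, Matrix.of_apply, Finset.sum_mul_sum, map_sum,
      Finset.sum_mul, map_mul]
    rw [Finset.sum_comm]
    refine Finset.sum_congr rfl fun b _ => ?_
    rw [Finset.sum_comm]
    refine Finset.sum_congr rfl fun b' _ => Finset.sum_congr rfl fun k _ => ?_
    ring
  rw [h, h, Finset.sum_comm]
  refine Finset.sum_congr rfl fun b' _ => Finset.sum_congr rfl fun b _ => ?_
  rw [yangBaxter_inl_inr_inr hR l a a' b b' m, mul_comm (MvPolynomial.X b)]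

section PassHom

variable {R : DefMatrix} (hR : IsDeformation R)
  {ρ : Poly →ₐ[ℂ] Matrix (Fin 4) (Fin 4) Poly} (hρ : ∀ a, ρ (MvPolynomial.X a) = passMat R a)

-- On the generators this is commutation of slices, and multiplicativity of ρ propagates it. It
-- makes the operators of the x₁ˡ commute.
include hR hρ in
theorem pass_pass_comm (f : Poly) (l l' m m' : Fin 4) : ρ (ρ f l' m') l m = ρ (ρ f l m) l' m' := by
  have hX : ∀ a l l' m m', ρ (ρ (MvPolynomial.X a) l' m') l m =
      ∑ b', MvPolynomial.C (∑ b, R l' a b m' * R l b b' m) * MvPolynomial.X b' := by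
    intro a l l' m m'
    have hC : ∀ c : ℂ, ρ (MvPolynomial.C c) = algebraMap ℂ _ c := fun c => ρ.commutes c
    simp only [hρ, passMat, Matrix.of_apply, map_sum, map_mul, hC, Matrix.sum_apply,
      ← Algebra.smul_def, Matrix.smul_apply, MvPolynomial.smul_eq_C_mul, Finset.mul_sum,
      Finset.sum_mul]
    rw [Finset.sum_comm]
    exact Finset.sum_congr rfl fun b' _ => Finset.sum_congr rfl fun b _ => by ring
  induction f using MvPolynomial.induction_on generalizing l l' m m' with
  | C c =>
    have hC : ρ (MvPolynomial.C c) = algebraMap ℂ _ c := ρ.commutes c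
    have h1 : ∀ i j : Fin 4, (algebraMap ℂ (Matrix (Fin 4) (Fin 4) Poly) c) i j =
        if i = j then algebraMap ℂ Poly c else 0 := fun i j => Matrix.algebraMap_matrix_apply
    rw [hC, h1, h1]
    split_ifs <;> simp [*]
  | add p q hp hq => simp only [map_add, Matrix.add_apply, hp, hq]
  | mul_X p a hp =>
    have hXs : ∀ l l' m m', ρ (ρ (MvPolynomial.X a) l' m') l m =
        ρ (ρ (MvPolynomial.X a) l m) l' m' := by
      intro l l' m m'
      rw [hX, hX]
      exact Finset.sum_congr rfl fun b' _ => by rw [yangBaxter_inl_inl_inr hR l' l a b' m' m]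
    simp only [map_mul, Matrix.mul_apply, map_sum, Matrix.sum_apply]
    rw [Finset.sum_comm]
    exact Finset.sum_congr rfl fun i _ => Finset.sum_congr rfl fun j _ => by rw [hp, hXs]

/-- The operator of `x₁ˡ` on polynomials in `x₂`, for the character `t` of the coordinates `x₁`. -/
def passOp (ρ : Poly →ₐ[ℂ] Matrix (Fin 4) (Fin 4) Poly) (t : Fin 4 → ℂ) (l : Fin 4) :
    Module.End ℂ Poly where
  toFun f := ∑ m, t m • ρ f l m
  map_add' f g := by simp [Finset.sum_add_distrib]
  map_smul' c f := by simp [Finset.smul_sum, smul_comm c]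

theorem passOp_apply (t : Fin 4 → ℂ) (l : Fin 4) (f : Poly) :
    passOp ρ t l f = ∑ m, t m • ρ f l m := rfl

/-- The operators of the generators on polynomials in `x₂`. -/
def genOp (ρ : Poly →ₐ[ℂ] Matrix (Fin 4) (Fin 4) Poly) (t : Fin 4 → ℂ) :
    Idx → Module.End ℂ Poly :=
  Sum.elim (passOp ρ t) fun a => LinearMap.mulLeft ℂ (MvPolynomial.X a)

-- This is the module induced from the character x₁ ↦ t: move x₁ˡ past f(x₂) by ρ, then evaluate at
-- t. The second mixed relation follows from the first by reality.
include hR hρ in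
theorem exists_rep (t : Fin 4 → ℂ) : ∃ π : QuadAlg R →ₐ[ℂ] Module.End ℂ Poly,
    ∀ i, π (QuadAlg.gen R i) = genOp ρ t i := by
  have hcomm : ∀ l m, genOp ρ t (Sum.inl l) * genOp ρ t (Sum.inl m) =
      genOp ρ t (Sum.inl m) * genOp ρ t (Sum.inl l) := by
    intro l l'
    refine LinearMap.ext fun f => ?_
    simp only [genOp, Sum.elim_inl, Module.End.mul_apply, passOp_apply, map_sum, map_smul,
      Finset.smul_sum]
    rw [Finset.sum_comm]
    exact Finset.sum_congr rfl fun m _ => Finset.sum_congr rfl fun m' _ => by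
      rw [pass_pass_comm hR hρ, smul_comm]
  have hmixed : ∀ l a, genOp ρ t (Sum.inl l) * genOp ρ t (Sum.inr a) =
      ∑ b, ∑ m, R l a b m • (genOp ρ t (Sum.inr b) * genOp ρ t (Sum.inl m)) := by
    intro l a
    refine LinearMap.ext fun f => ?_
    simp only [genOp, Sum.elim_inl, Sum.elim_inr, Module.End.mul_apply, passOp_apply, map_mul,
      LinearMap.mulLeft_apply, hρ, LinearMap.sum_apply, LinearMap.smul_apply, Matrix.mul_apply,
      passMat, Matrix.of_apply, Finset.mul_sum, Finset.sum_mul, Finset.smul_sum]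
    calc _ = ∑ k, ∑ m, ∑ b, t m • (MvPolynomial.C (R l a b k) * MvPolynomial.X b * ρ f k m) :=
          Finset.sum_comm
      _ = ∑ k, ∑ b, ∑ m, t m • (MvPolynomial.C (R l a b k) * MvPolynomial.X b * ρ f k m) :=
          Finset.sum_congr rfl fun k _ => Finset.sum_comm
      _ = ∑ b, ∑ k, ∑ m, t m • (MvPolynomial.C (R l a b k) * MvPolynomial.X b * ρ f k m) :=
          Finset.sum_comm
      _ = _ := by
          refine Finset.sum_congr rfl fun b _ => Finset.sum_congr rfl fun k _ =>
            Finset.sum_congr rfl fun m _ => ?_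
          simp only [MvPolynomial.smul_eq_C_mul]
          ring
  have hmixed' : ∀ l a, genOp ρ t (Sum.inr a) * genOp ρ t (Sum.inl l) =
      ∑ b, ∑ m, conj (R l a b m) • (genOp ρ t (Sum.inl m) * genOp ρ t (Sum.inr b)) := by
    intro l a
    simp_rw [hmixed, Finset.smul_sum, smul_smul]
    calc _ = ∑ c, ∑ n, (∑ b, ∑ m, conj (R l a b m) * R m b c n) •
          (genOp ρ t (Sum.inr c) * genOp ρ t (Sum.inl n)) := by
          simp_rw [hR.real, ite_smul, one_smul, zero_smul]
          rw [Finset.sum_eq_single a, Finset.sum_eq_single l] <;> simp +contextual [eq_comm]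
      _ = ∑ c, ∑ n, ∑ b, ∑ m, (conj (R l a b m) * R m b c n) •
          (genOp ρ t (Sum.inr c) * genOp ρ t (Sum.inl n)) := by
          simp_rw [Finset.sum_smul]
      _ = ∑ c, ∑ b, ∑ n, ∑ m, (conj (R l a b m) * R m b c n) •
          (genOp ρ t (Sum.inr c) * genOp ρ t (Sum.inl n)) :=
          Finset.sum_congr rfl fun c _ => Finset.sum_comm
      _ = ∑ b, ∑ c, ∑ n, ∑ m, (conj (R l a b m) * R m b c n) •
          (genOp ρ t (Sum.inr c) * genOp ρ t (Sum.inl n)) := Finset.sum_comm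
      _ = ∑ b, ∑ c, ∑ m, ∑ n, (conj (R l a b m) * R m b c n) •
          (genOp ρ t (Sum.inr c) * genOp ρ t (Sum.inl n)) :=
          Finset.sum_congr rfl fun b _ => Finset.sum_congr rfl fun c _ => Finset.sum_comm
      _ = _ := Finset.sum_congr rfl fun b _ => Finset.sum_comm
  have hrel : ∀ ⦃x y⦄, QuadRel R x y →
      FreeAlgebra.lift ℂ (genOp ρ t) x = FreeAlgebra.lift ℂ (genOp ρ t) y := by
    intro x y h
    cases h with
    | comm₁ l m => simp only [map_mul, FreeAlgebra.lift_ι_apply, hcomm]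
    | comm₂ a b =>
      simp only [map_mul, FreeAlgebra.lift_ι_apply]
      refine LinearMap.ext fun f => ?_
      simp [genOp, mul_left_comm]
    | mixed l a =>
      simp only [map_mul, map_sum, FreeAlgebra.lift_ι_apply, ← Algebra.smul_def, map_smul, hmixed]
    | mixed' l a =>
      simp only [map_mul, map_sum, FreeAlgebra.lift_ι_apply, ← Algebra.smul_def, map_smul, hmixed']
  refine ⟨RingQuot.liftAlgHom ℂ ⟨FreeAlgebra.lift ℂ (genOp ρ t), hrel⟩, fun i => ?_⟩
  have := RingQuot.liftAlgHom_mkAlgHom_apply ℂ (FreeAlgebra.lift ℂ (genOp ρ t)) hrel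
    (FreeAlgebra.ι ℂ i)
  rw [FreeAlgebra.lift_ι_apply] at this
  exact this

end PassHom

/-- The ring congruence of the kernel of a quotient map is contained in every congruence that
contains the relations. -/
theorem sphere_congr {R : DefMatrix} (c : RingCon (QuadAlg R))
    (hc : c (QuadAlg.sq₁ R + QuadAlg.sq₂ R) 1) {a b : QuadAlg R}
    (h : Sphere7.mk R a = Sphere7.mk R b) : c a b := by
  have hrel : ∀ ⦃x y⦄, SphereRel R x y → c.mk' x = c.mk' y := by
    intro x y h
    cases h
    exact (RingCon.eq c).2 hc
  let F : RingQuot (SphereRel R) →+* c.Quotient := RingQuot.lift ⟨c.mk', hrel⟩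
  have hF : ∀ x, F (RingQuot.mkRingHom (SphereRel R) x) = c.mk' x := fun x =>
    RingQuot.lift_mkRingHom_apply c.mk' hrel x
  have hmk : ∀ x, Sphere7.mk R x = RingQuot.mkRingHom (SphereRel R) x := fun x =>
    congrFun (congrArg DFunLike.coe (RingQuot.mkAlgHom_coe ℂ (SphereRel R))) x
  have : c.mk' a = c.mk' b := by
    rw [← hF, ← hF]
    exact congrArg F ((hmk a).symm.trans (h.trans (hmk b)))
  exact (RingCon.eq c).1 this

/-- Apply an element to the vector 1 of the induced module and evaluate the resulting polynomial at
s. Centrality brings the sphere relation to the left, where it acts after evaluation as ∑ t² + ∑ s²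
= 1. -/
theorem exists_functional {R : DefMatrix} (hR : IsDeformation R) (s t : Fin 4 → ℂ)
    (hst : ∑ l, t l ^ 2 + ∑ a, s a ^ 2 = 1) : ∃ φ : QuadAlg R →ₗ[ℂ] ℂ,
    (∀ a b, Sphere7.mk R a = Sphere7.mk R b → φ a = φ b) ∧
      ∀ b m, φ (QuadAlg.gen R (Sum.inr b) * QuadAlg.gen R (Sum.inl m)) = s b * t m := by
  obtain ⟨ρ, hρ⟩ := exists_algHom_of_commute (passMat R) (passMat_comm hR)
  obtain ⟨π, hπ⟩ := exists_rep hR hρ t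
  have hone : ∀ l, passOp ρ t l 1 = t l • 1 := by
    intro l
    simp [passOp_apply, Matrix.one_apply]
  -- A central element that is scalar on the cyclic vector 1 is scalar on everything generated from
  -- it.
  have hsq₁ : ∀ f, π (QuadAlg.sq₁ R) f = (∑ l, t l ^ 2) • f := by
    intro f
    induction f using MvPolynomial.induction_on with
    | C c =>
      have : (MvPolynomial.C c : Poly) = c • 1 := by rw [MvPolynomial.smul_eq_C_mul, mul_one]
      rw [this, map_smul, smul_comm]
      congr 1
      simp only [QuadAlg.sq₁, QuadAlg.x₁, map_sum, map_mul, hπ, genOp, Sum.elim_inl, sq,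
        LinearMap.sum_apply, Module.End.mul_apply, hone, map_smul, Finset.sum_smul, smul_smul]
    | add p q hp hq => rw [map_add, hp, hq, smul_add]
    | mul_X p a hp =>
      have h := congrArg π ((Subalgebra.mem_center_iff.1 hR.central₁) (QuadAlg.gen R (Sum.inr a)))
      have h' := congrArg (fun T : Module.End ℂ Poly => T p) h
      simp only [map_mul, hπ, genOp, Sum.elim_inr, Module.End.mul_apply, LinearMap.mulLeft_apply,
        hp] at h'
      rw [mul_comm p, ← h', mul_smul_comm]
  have hsq₂ : ∀ f, π (QuadAlg.sq₂ R) f = (∑ a, MvPolynomial.X a ^ 2) * f := by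
    intro f
    simp [QuadAlg.sq₂, QuadAlg.x₂, hπ, genOp, sq, LinearMap.sum_apply, Finset.sum_mul, mul_assoc]
  let φ : QuadAlg R →ₗ[ℂ] ℂ :=
    (MvPolynomial.aeval s).toLinearMap ∘ₗ LinearMap.applyₗ (1 : Poly) ∘ₗ π.toLinearMap
  have hφ : ∀ a, φ a = MvPolynomial.aeval s (π a 1) := fun a => rfl
  have hunit : ∀ u v, φ (u * (QuadAlg.sq₁ R + QuadAlg.sq₂ R) * v) = φ (u * 1 * v) := by
    intro u v
    have h := (Subalgebra.mem_center_iff.1 (add_mem hR.central₁ hR.central₂)) u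
    rw [h, mul_assoc, mul_one, hφ, map_mul, Module.End.mul_apply, map_add, LinearMap.add_apply,
      hsq₁, hsq₂, hφ, map_add, map_smul, map_mul, map_mul, smul_eq_mul,
      ← add_mul]
    simp [hst]
  let c : RingCon (QuadAlg R) :=
    { r := fun a b => ∀ u v, φ (u * a * v) = φ (u * b * v)
      iseqv := ⟨fun _ _ _ => rfl, fun h u v => (h u v).symm, fun h h' u v =>
        (h u v).trans (h' u v)⟩
      mul' := fun {a b a' b'} h h' u v => by
        have h1 := h u (a' * v)
        have h2 := h' (u * b) v
        simp only [mul_assoc] at h1 h2 ⊢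
        rw [h1, h2]
      add' := fun {a b a' b'} h h' u v => by
        simp only [mul_add, add_mul, map_add, h u v, h' u v] }
  refine ⟨φ, fun a b h => ?_, fun b m => ?_⟩
  · have : ∀ u v, φ (u * a * v) = φ (u * b * v) := sphere_congr c hunit h
    simpa using this 1 1
  · rw [hφ, map_mul, hπ, hπ, Module.End.mul_apply]
    simp [genOp, hone, mul_comm]

/-- The ordered words `x₂ᵇ x₁ᵐ` are linearly independent. -/
theorem ordered_words_independent {R : DefMatrix} (hR : IsDeformation R) {c : Fin 4 → Fin 4 → ℂ}
    (h : ∑ b, ∑ m, c b m • (Sphere7.x R (Sum.inr b) * Sphere7.x R (Sum.inl m)) = 0) (b m : Fin 4) :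
    c b m = 0 := by
  -- A rational point of S⁷ with one nonzero coordinate in each ℝ⁴ isolates the coefficient c b m.
  obtain ⟨φ, h1, h2⟩ := exists_functional hR (Pi.single b (3 / 5)) (Pi.single m (4 / 5)) (by
    simp [Pi.single_apply, ite_pow]
    norm_num)
  have h3 := h1 (∑ b, ∑ m, c b m • (QuadAlg.gen R (Sum.inr b) * QuadAlg.gen R (Sum.inl m))) 0 (by
    rw [map_zero, ← h]
    simp only [map_sum, map_smul, map_mul, Sphere7.x])
  simp only [map_sum, map_smul, h2, map_zero, Pi.single_apply, smul_eq_mul, mul_ite, ite_mul,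
    zero_mul, mul_zero, Finset.sum_ite_eq', Finset.mem_univ, if_true] at h3
  simpa using h3

/-! ### Equivariance of the deformation matrix -/

/-- The defect of the equivariance of `R` under the pair of matrices `M`, `N`. -/
def defect (R : DefMatrix) (M N : Matrix (Fin 4) (Fin 4) ℂ) (l a b m : Fin 4) : ℂ :=
  ∑ k, ∑ n, M l k * N a n * R k n b m - ∑ n, ∑ k, R l a n k * (N n b * M k m)

theorem Sphere7.x_comm (R : DefMatrix) (l m : Fin 4) :
    Sphere7.x R (Sum.inl l) * Sphere7.x R (Sum.inl m) =
        Sphere7.x R (Sum.inl m) * Sphere7.x R (Sum.inl l) ∧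
      Sphere7.x R (Sum.inr l) * Sphere7.x R (Sum.inr m) =
        Sphere7.x R (Sum.inr m) * Sphere7.x R (Sum.inr l) := by
  have h1 := congrArg (Sphere7.mk R) (QuadAlg.mk_rel R (QuadRel.comm₁ (R := R) l m))
  have h2 := congrArg (Sphere7.mk R) (QuadAlg.mk_rel R (QuadRel.comm₂ (R := R) l m))
  simp only [map_mul] at h1 h2
  exact ⟨h1, h2⟩

theorem Sphere7.x_mixed (R : DefMatrix) (l a : Fin 4) :
    Sphere7.x R (Sum.inl l) * Sphere7.x R (Sum.inr a) =
      ∑ b, ∑ m, R l a b m • (Sphere7.x R (Sum.inr b) * Sphere7.x R (Sum.inl m)) := by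
  have h := congrArg (Sphere7.mk R) (QuadAlg.mk_rel R (QuadRel.mixed (R := R) l a))
  simp only [map_mul, map_sum, ← Algebra.smul_def, map_smul] at h
  exact h

theorem Sphere7.x_unit (R : DefMatrix) :
    ∑ l, Sphere7.x R (Sum.inl l) ^ 2 + ∑ a, Sphere7.x R (Sum.inr a) ^ 2 = 1 := by
  have h : Sphere7.mk R (QuadAlg.sq₁ R + QuadAlg.sq₂ R) = Sphere7.mk R 1 :=
    RingQuot.mkAlgHom_rel ℂ SphereRel.unit
  simpa [QuadAlg.sq₁, QuadAlg.sq₂, QuadAlg.x₁, QuadAlg.x₂, Sphere7.x] using h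

theorem sum_four_comm {V : Type*} [AddCommMonoid V] (F : Fin 4 → Fin 4 → Fin 4 → Fin 4 → V) :
    ∑ i, ∑ j, ∑ k, ∑ l, F i j k l = ∑ k, ∑ l, ∑ i, ∑ j, F i j k l := by
  calc _ = ∑ i, ∑ k, ∑ j, ∑ l, F i j k l := Finset.sum_congr rfl fun i _ => Finset.sum_comm
    _ = ∑ k, ∑ i, ∑ j, ∑ l, F i j k l := Finset.sum_comm
    _ = ∑ k, ∑ i, ∑ l, ∑ j, F i j k l :=
        Finset.sum_congr rfl fun k _ => Finset.sum_congr rfl fun i _ => Finset.sum_comm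
    _ = _ := Finset.sum_congr rfl fun k _ => Finset.sum_comm

/-- Apply f to the mixed relation, reorder both sides, and compare coefficients of the independent
words x₂x₁. -/
theorem defect_eq_zero {R : DefMatrix} (hR : IsDeformation R) (M : Matrix (Fin 4) (Fin 4) ℂ)
    (f : Sphere7 R →ₐ[ℂ] Sphere7 R)
    (h₁ : ∀ l, f (Sphere7.x R (Sum.inl l)) = ∑ k, M l k • Sphere7.x R (Sum.inl k))
    (h₂ : ∀ a, f (Sphere7.x R (Sum.inr a)) = ∑ k, M a k • Sphere7.x R (Sum.inr k))
    (l a b m : Fin 4) : defect R M M l a b m = 0 := by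
  refine ordered_words_independent hR (c := fun b m => defect R M M l a b m) ?_ b m
  have h := congrArg f (Sphere7.x_mixed R l a)
  rw [map_mul, h₁, h₂] at h
  simp only [map_mul, map_sum, map_smul, h₁, h₂] at h
  simp only [Finset.sum_mul_sum, smul_mul_smul_comm, Sphere7.x_mixed, Finset.smul_sum,
    smul_smul] at h
  have e1 : ∑ k, ∑ n, ∑ b, ∑ m, (M l k * M a n * R k n b m) •
      (Sphere7.x R (Sum.inr b) * Sphere7.x R (Sum.inl m)) =
      ∑ b, ∑ m, (∑ k, ∑ n, M l k * M a n * R k n b m) •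
      (Sphere7.x R (Sum.inr b) * Sphere7.x R (Sum.inl m)) := by
    simp_rw [Finset.sum_smul]
    exact sum_four_comm _
  have e2 : ∑ n, ∑ k, ∑ b, ∑ m, (R l a n k * (M n b * M k m)) •
      (Sphere7.x R (Sum.inr b) * Sphere7.x R (Sum.inl m)) =
      ∑ b, ∑ m, (∑ n, ∑ k, R l a n k * (M n b * M k m)) •
      (Sphere7.x R (Sum.inr b) * Sphere7.x R (Sum.inl m)) := by
    simp_rw [Finset.sum_smul]
    exact sum_four_comm _
  simp only [defect, sub_smul, Finset.sum_sub_distrib]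
  rw [← e1, ← e2, h, sub_self]

theorem defect_add_left (R : DefMatrix) (M M' N : Matrix (Fin 4) (Fin 4) ℂ) (l a b m : Fin 4) :
    defect R (M + M') N l a b m = defect R M N l a b m + defect R M' N l a b m := by
  simp only [defect, Matrix.add_apply, add_mul, mul_add, Finset.sum_add_distrib]
  abel

theorem defect_add_right (R : DefMatrix) (M N N' : Matrix (Fin 4) (Fin 4) ℂ) (l a b m : Fin 4) :
    defect R M (N + N') l a b m = defect R M N l a b m + defect R M N' l a b m := by
  simp only [defect, Matrix.add_apply, add_mul, mul_add, Finset.sum_add_distrib]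
  abel

theorem defect_smul (R : DefMatrix) (c s : ℂ) (M N : Matrix (Fin 4) (Fin 4) ℂ)
    (l a b m : Fin 4) : defect R (c • M) (s • N) l a b m = c * s * defect R M N l a b m := by
  simp only [defect, Matrix.smul_apply, smul_eq_mul, mul_sub, Finset.mul_sum]
  congr 1 <;> exact Finset.sum_congr rfl fun i _ => Finset.sum_congr rfl fun j _ => by ring

/-- Bilinearity, together with the vanishing of the defect at (1, 1), leaves a mixed term, the
infinitesimal defect, and a term in s². -/
theorem defect_bilinear (R : DefMatrix) (c s : ℂ) (E : Matrix (Fin 4) (Fin 4) ℂ) (l a b m : Fin 4) :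
    defect R (c • 1 + s • E) (c • 1 + s • E) l a b m =
      c * s * (defect R 1 E l a b m + defect R E 1 l a b m) + s ^ 2 * defect R E E l a b m := by
  have h : defect R 1 1 l a b m = 0 := by simp [defect, Matrix.one_apply]
  simp only [defect_add_left, defect_add_right, defect_smul, h]
  ring

theorem defect_one (R : DefMatrix) (E : Matrix (Fin 4) (Fin 4) ℂ) (l a b m : Fin 4) :
    defect R 1 E l a b m + defect R E 1 l a b m =
      (∑ n, E l n • slice R n m + E * slice R l m -
        (slice R l m * E + ∑ n, E n m • slice R l n)) a b := by
  simp [defect, Matrix.one_apply, Matrix.mul_apply, Matrix.sum_apply, slice]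
  simp only [mul_comm]
  ring

/-- The quaternion `c + s e_k`. -/
theorem exists_unit_quaternion {c s : ℝ} (h : c ^ 2 + s ^ 2 = 1) {k : Fin 4} (hk : k ≠ 0) :
    ∃ u : unitary ℍ[ℝ], ∀ μ, qcoord (u : ℍ[ℝ]) μ =
      (if μ = 0 then c else 0) + (if μ = k then s else 0) := by
  have key : ∀ q : ℍ[ℝ], Quaternion.normSq q = 1 → q ∈ unitary ℍ[ℝ] := by
    intro q hq
    rw [Unitary.mem_iff, Quaternion.star_mul_self, Quaternion.self_mul_star, hq]
    simp
  fin_cases k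
  · exact absurd rfl hk
  · refine ⟨⟨⟨c, s, 0, 0⟩, key _ ?_⟩, fun μ => ?_⟩
    · exact (Quaternion.normSq_def' _).trans (by simpa using h)
    · fin_cases μ <;> simp [qcoord]
  · refine ⟨⟨⟨c, 0, s, 0⟩, key _ ?_⟩, fun μ => ?_⟩
    · exact (Quaternion.normSq_def' _).trans (by simpa using h)
    · fin_cases μ <;> simp [qcoord]
  · refine ⟨⟨⟨c, 0, 0, s⟩, key _ ?_⟩, fun μ => ?_⟩
    · exact (Quaternion.normSq_def' _).trans (by simpa using h)
    · fin_cases μ <;> simp [qcoord]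

/-- The index of the component `μ` of the entry `i` of `|ψ⟩`. -/
def ketIdx : Fin 2 → Fin 4 → Idx := ![Sum.inr, Sum.inl]

theorem ket_eq (R : DefMatrix) (i : Fin 2) (μ : Fin 4) :
    Sphere7.ket R i μ = Sphere7.x R (ketIdx i μ) := by
  fin_cases i <;> rfl

section Action

variable {R : DefMatrix} (hR : IsDeformation R) (α : unitary ℍ[ℝ] → (Sphere7 R ≃⋆ₐ[ℂ] Sphere7 R))
  (hα : ∀ (u : unitary ℍ[ℝ]) (i : Fin 2) (μ : Fin 4),
    α u (Sphere7.ket R i μ) = qmul (Sphere7.ket R i) (qscalar (Sphere7 R) u) μ)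

include hα in
theorem action_x (u : unitary ℍ[ℝ]) {c s : ℝ} {k : Fin 4}
    (hu : ∀ μ, qcoord (u : ℍ[ℝ]) μ = (if μ = 0 then c else 0) + (if μ = k then s else 0))
    (i : Fin 2) (l : Fin 4) : α u (Sphere7.x R (ketIdx i l)) =
      ∑ n, ((c : ℂ) • (1 : Matrix (Fin 4) (Fin 4) ℂ) + (s : ℂ) • unitMat ℂ k) l n •
        Sphere7.x R (ketIdx i n) := by
  have hq : ∀ μ, qscalar (Sphere7 R) u μ =
      ((if μ = 0 then (c : ℂ) else 0) + (if μ = k then (s : ℂ) else 0)) • (1 : Sphere7 R) := by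
    intro μ
    rw [qscalar, hu, Algebra.algebraMap_eq_smul_one]
    congr 1
    split_ifs <;> simp
  rw [← ket_eq, hα, qmul_eq_sum, Finset.sum_comm]
  refine Finset.sum_congr rfl fun n _ => ?_
  rw [← unitMat_zero]
  simp_rw [hq, ket_eq, mul_smul_comm, mul_one, ← Int.cast_smul_eq_zsmul ℂ, smul_smul, ← Finset.sum_smul]
  congr 1
  simp_rw [mul_comm _ (_ + _), add_mul]
  simp [Finset.sum_add_distrib, unitMat]

include hR hα in
theorem slice_equivariant (k l m : Fin 4) :
    ∑ n, unitMat ℂ k l n • slice R n m + unitMat ℂ k * slice R l m =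
      slice R l m * unitMat ℂ k + ∑ n, unitMat ℂ k n m • slice R l n := by
  by_cases hk : k = 0
  · subst hk
    simp [unitMat_zero, Matrix.one_apply]
  have key : ∀ c s : ℝ, c ^ 2 + s ^ 2 = 1 → ∀ a b,
      defect R ((c : ℂ) • 1 + (s : ℂ) • unitMat ℂ k) ((c : ℂ) • 1 + (s : ℂ) • unitMat ℂ k)
        l a b m = 0 := by
    intro c s h a b
    obtain ⟨u, hu⟩ := exists_unit_quaternion h hk
    exact defect_eq_zero hR _ ((α u).toAlgEquiv : Sphere7 R →ₐ[ℂ] Sphere7 R)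
      (fun l => action_x α hα u hu 1 l) (fun a => action_x α hα u hu 0 a) l a b m
  rw [← sub_eq_zero]
  ext a b
  -- The unit e_k kills the s² term; the unit quaternion 3/5 + 4/5 e_k then isolates the mixed term,
  -- so no differentiation is needed.
  have h1 := key 0 1 (by norm_num) a b
  have h2 := key (3 / 5) (4 / 5) (by norm_num) a b
  rw [defect_bilinear] at h1 h2
  simp only [Complex.ofReal_zero, zero_mul, Complex.ofReal_one, one_pow, one_mul, zero_add] at h1
  rw [h1, mul_zero, add_zero] at h2
  rw [← defect_one]
  refine (mul_eq_zero.1 h2).resolve_left ?_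
  norm_num

include hR hα in
theorem slice_commute (k l m : Fin 4) :
    slice R l m * unitMat ℂ k = unitMat ℂ k * slice R l m :=
  slice_unitMat hR (slice_equivariant hR α hα) k l m

end Action

/-! ### The frame of the seven-sphere -/

/-- The components of the quaternion `a` multiplied by a unit on the right. -/
def rmul {A : Type*} [Ring A] (a : Fin 4 → A) (μ i : Fin 4) : A := ∑ k, rightMat μ i k • a k

theorem rmul_zero {A : Type*} [Ring A] (a : Fin 4 → A) (i : Fin 4) : rmul a 0 i = a i := by
  simp [rmul, rightMat, Matrix.one_apply]

theorem star_rmul {A : Type*} [Ring A] [StarRing A] {a : Fin 4 → A} (ha : ∀ i, star (a i) = a i)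
    (μ i : Fin 4) : star (rmul a μ i) = rmul a μ i := by
  simp only [rmul, star_sum, star_zsmul, ha]

theorem rmul_comm {A : Type*} [Ring A] {a : Fin 4 → A} (ha : ∀ i j, a i * a j = a j * a i)
    (μ ν i j : Fin 4) : rmul a μ i * rmul a ν j = rmul a ν j * rmul a μ i := by
  simp only [rmul, Finset.sum_mul_sum, smul_mul_smul_comm]
  rw [Finset.sum_comm]
  exact Finset.sum_congr rfl fun k _ => Finset.sum_congr rfl fun n _ => by rw [ha, mul_comm]

/-- For commuting coordinates only the symmetric part of G contributes. -/
theorem sum_quadratic_form {A : Type*} [Ring A] [Algebra ℂ A] {a : Fin 4 → A}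
    (ha : ∀ i j, a i * a j = a j * a i) (G : Fin 4 → Fin 4 → ℤ) (c : ℤ)
    (hG : ∀ i j, G i j + G j i = 2 * if i = j then c else 0) :
    ∑ i, ∑ j, G i j • (a i * a j) = c • ∑ i, a i ^ 2 := by
  have h : (2 : ℂ) • ∑ i, ∑ j, G i j • (a i * a j) = (2 : ℂ) • (c • ∑ i, a i ^ 2) := by
    calc _ = ∑ i, ∑ j, G i j • (a i * a j) + ∑ i, ∑ j, G j i • (a j * a i) := by
          rw [two_smul]; congr 1; exact Finset.sum_comm
      _ = ∑ i, ∑ j, (G i j + G j i) • (a i * a j) := by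
          simp_rw [← Finset.sum_add_distrib]
          exact Finset.sum_congr rfl fun i _ => Finset.sum_congr rfl fun j _ => by
            rw [ha j i, add_smul]
      _ = _ := by
          simp_rw [hG, two_smul, two_mul, add_smul, ite_smul, zero_smul, Finset.sum_add_distrib]
          simp [Finset.smul_sum, sq]
  exact smul_right_injective A (two_ne_zero (α := ℂ)) h

theorem sum_rmul_mul_rmul {A : Type*} [Ring A] [Algebra ℂ A] {a : Fin 4 → A}
    (ha : ∀ i j, a i * a j = a j * a i) (μ ν : Fin 4) :
    ∑ l, rmul a μ l * rmul a ν l = if μ = ν then ∑ i, a i ^ 2 else 0 := by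
  have hG : ∀ μ ν i j : Fin 4, ∑ l, rightMat μ l i * rightMat ν l j +
      ∑ l, rightMat μ l j * rightMat ν l i =
        2 * if i = j then (if μ = ν then 1 else 0) else 0 := by decide
  have := sum_quadratic_form ha _ _ (hG μ ν)
  rw [ite_smul, one_smul, zero_smul] at this
  rw [← this]
  simp only [rmul, Finset.sum_mul_sum, smul_mul_smul_comm, Finset.sum_smul]
  rw [Finset.sum_comm]
  exact Finset.sum_congr rfl fun k _ => Finset.sum_comm

theorem sum_rmul_mul_rmul' {A : Type*} [Ring A] [Algebra ℂ A] {a : Fin 4 → A}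
    (ha : ∀ i j, a i * a j = a j * a i) (l m : Fin 4) :
    ∑ μ, rmul a μ l * rmul a μ m = if l = m then ∑ i, a i ^ 2 else 0 := by
  have hG : ∀ l m i j : Fin 4, ∑ μ, rightMat μ l i * rightMat μ m j +
      ∑ μ, rightMat μ l j * rightMat μ m i =
        2 * if i = j then (if l = m then 1 else 0) else 0 := by decide
  have := sum_quadratic_form ha _ _ (hG l m)
  rw [ite_smul, one_smul, zero_smul] at this
  rw [← this]
  simp only [rmul, Finset.sum_mul_sum, smul_mul_smul_comm, Finset.sum_smul]
  rw [Finset.sum_comm]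
  exact Finset.sum_congr rfl fun k _ => Finset.sum_comm

/-- The frame of the seven-sphere: the components of `x₁ e_μ` and `x₂ e_μ`. -/
def sphereFrame (R : DefMatrix) : Idx → Fin 4 → Sphere7 R :=
  Sum.elim (fun l μ => rmul (fun k => Sphere7.x R (Sum.inl k)) μ l)
    (fun a μ => rmul (fun k => Sphere7.x R (Sum.inr k)) μ a)

theorem sphereFrame_ketIdx (R : DefMatrix) (i : Fin 2) (l μ : Fin 4) :
    sphereFrame R (ketIdx i l) μ = rmul (Sphere7.ket R i) μ l := by
  fin_cases i <;> rfl

theorem sphereFrame_zero (R : DefMatrix) (I : Idx) : sphereFrame R I 0 = Sphere7.x R I := by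
  cases I with
  | inl l => exact rmul_zero (fun k => Sphere7.x R (Sum.inl k)) l
  | inr a => exact rmul_zero (fun k => Sphere7.x R (Sum.inr k)) a

theorem Sphere7.star_x (R : DefMatrix) (I : Idx) : star (Sphere7.x R I) = Sphere7.x R I := by
  rw [Sphere7.x, Sphere7.star_mk, QuadAlg.star_gen]

theorem star_sphereFrame (R : DefMatrix) (I : Idx) (μ : Fin 4) :
    star (sphereFrame R I μ) = sphereFrame R I μ := by
  cases I <;> exact star_rmul (fun _ => Sphere7.star_x R _) _ _

theorem Sphere7.adjoin_x (R : DefMatrix) : Algebra.adjoin ℂ (Set.range (Sphere7.x R)) = ⊤ := by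
  rw [eq_top_iff]
  intro a _
  obtain ⟨a, rfl⟩ := Sphere7.mk_surjective R a
  obtain ⟨a, rfl⟩ := QuadAlg.mk_surjective R a
  induction a using FreeAlgebra.induction with
  | grade0 c => rw [AlgHom.commutes, AlgHom.commutes]; exact Subalgebra.algebraMap_mem _ c
  | grade1 i => exact Algebra.subset_adjoin ⟨i, rfl⟩
  | mul a b ha hb => rw [map_mul, map_mul]; exact Subalgebra.mul_mem _ (ha trivial) (hb trivial)
  | add a b ha hb => rw [map_add, map_add]; exact Subalgebra.add_mem _ (ha trivial) (hb trivial)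

theorem sphereFrame_orth (R : DefMatrix) (μ ν : Fin 4) :
    ∑ I, sphereFrame R I μ * sphereFrame R I ν = if μ = ν then 1 else 0 := by
  rw [Fintype.sum_sum_type]
  simp only [sphereFrame, Sum.elim_inl, Sum.elim_inr]
  rw [sum_rmul_mul_rmul fun i j => (Sphere7.x_comm R i j).1,
    sum_rmul_mul_rmul fun i j => (Sphere7.x_comm R i j).2]
  split_ifs
  · exact Sphere7.x_unit R
  · exact add_zero 0

theorem sphereFrame_comm (R : DefMatrix) (l m μ ν : Fin 4) :
    sphereFrame R (Sum.inl l) μ * sphereFrame R (Sum.inl m) ν =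
        sphereFrame R (Sum.inl m) ν * sphereFrame R (Sum.inl l) μ ∧
      sphereFrame R (Sum.inr l) μ * sphereFrame R (Sum.inr m) ν =
        sphereFrame R (Sum.inr m) ν * sphereFrame R (Sum.inr l) μ :=
  ⟨rmul_comm (fun i j => (Sphere7.x_comm R i j).1) _ _ _ _,
    rmul_comm (fun i j => (Sphere7.x_comm R i j).2) _ _ _ _⟩

theorem rmul_eq_sum {A : Type*} [Ring A] [Algebra ℂ A] (a : Fin 4 → A) (μ i : Fin 4) :
    rmul a μ i = ∑ k, unitMat ℂ μ i k • a k := by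
  simp [rmul, unitMat, Int.cast_smul_eq_zsmul]

/-- Subtracting the symmetry under 1 ⊗ E_k from the diagonal one leaves E_k ⊗ 1, so E_μ and E_ν pass
through R independently. -/
theorem sum_unit_R {R : DefMatrix}
    (hc : ∀ k l m, slice R l m * unitMat ℂ k = unitMat ℂ k * slice R l m)
    (he : ∀ k l m, ∑ n, unitMat ℂ k l n • slice R n m + unitMat ℂ k * slice R l m =
      slice R l m * unitMat ℂ k + ∑ n, unitMat ℂ k n m • slice R l n) (μ ν l a b m : Fin 4) :
    ∑ k, ∑ n, unitMat ℂ μ l k * unitMat ℂ ν a n * R k n b m =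
      ∑ n, ∑ k, R l a n k * (unitMat ℂ ν n b * unitMat ℂ μ k m) := by
  have h1 : ∀ l m, ∑ n, unitMat ℂ ν a n * R l n b m = ∑ n, R l a n m * unitMat ℂ ν n b := by
    intro l m
    have := congrFun (congrFun (hc ν l m) a) b
    simp only [Matrix.mul_apply, slice] at this
    exact this.symm
  have h2 : ∀ n, ∑ k, unitMat ℂ μ l k * R k a n m = ∑ k, R l a n k * unitMat ℂ μ k m := by
    intro n
    have h := he μ l m
    rw [hc, add_comm, add_right_inj] at h
    have := congrFun (congrFun h a) n
    simp only [Matrix.sum_apply, Matrix.smul_apply, slice, smul_eq_mul] at this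
    rw [this]
    exact Finset.sum_congr rfl fun k _ => mul_comm _ _
  calc _ = ∑ k, unitMat ℂ μ l k * ∑ n, R k a n m * unitMat ℂ ν n b := by
        simp_rw [mul_assoc, ← Finset.mul_sum, h1]
    _ = ∑ n, (∑ k, unitMat ℂ μ l k * R k a n m) * unitMat ℂ ν n b := by
        simp_rw [Finset.mul_sum, Finset.sum_mul, mul_assoc]
        exact Finset.sum_comm
    _ = _ := by
        simp_rw [h2, Finset.sum_mul]
        exact Finset.sum_congr rfl fun k _ => Finset.sum_congr rfl fun n _ => by ring

section Exchange

variable {R : DefMatrix} (hR : IsDeformation R)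
  (hc : ∀ k l m, slice R l m * unitMat ℂ k = unitMat ℂ k * slice R l m)
  (he : ∀ k l m, ∑ n, unitMat ℂ k l n • slice R n m + unitMat ℂ k * slice R l m =
    slice R l m * unitMat ℂ k + ∑ n, unitMat ℂ k n m • slice R l n)

include hc he in
theorem sphereFrame_mixed (l a μ ν : Fin 4) :
    sphereFrame R (Sum.inl l) μ * sphereFrame R (Sum.inr a) ν =
      ∑ b, ∑ m, R l a b m • (sphereFrame R (Sum.inr b) ν * sphereFrame R (Sum.inl m) μ) := by
  simp only [sphereFrame, Sum.elim_inl, Sum.elim_inr, rmul_eq_sum, Finset.sum_mul_sum,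
    smul_mul_smul_comm, Sphere7.x_mixed, Finset.smul_sum, smul_smul]
  rw [sum_four_comm]
  conv_rhs => rw [sum_four_comm]
  refine Finset.sum_congr rfl fun b _ => Finset.sum_congr rfl fun m _ => ?_
  simp_rw [← Finset.sum_smul]
  rw [sum_unit_R hc he]

include hR hc he in
theorem sphereFrame_mixed' (l a μ ν : Fin 4) :
    sphereFrame R (Sum.inr a) ν * sphereFrame R (Sum.inl l) μ =
      ∑ b, ∑ m, conj (R l a b m) •
        (sphereFrame R (Sum.inl m) μ * sphereFrame R (Sum.inr b) ν) := by
  simp_rw [sphereFrame_mixed hc he, Finset.smul_sum, smul_smul]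
  rw [sum_four_comm]
  simp_rw [← Finset.sum_smul, hR.real, ite_smul, one_smul, zero_smul]
  rw [Finset.sum_eq_single a, Finset.sum_eq_single l] <;> simp +contextual [eq_comm]

theorem exists_exchange_coeff {ι A κ : Type*} [Fintype ι] [Fintype κ] [Ring A] [Algebra ℂ A]
    {y : ι → Fin 4 → A} {I J : ι} (c : κ → ℂ) (p q : κ → ι)
    (h : ∀ μ ν, y I μ * y J ν = ∑ i, c i • (y (p i) ν * y (q i) μ)) :
    ∃ c : ι → ι → ℂ, ∀ μ ν, y I μ * y J ν = ∑ K, ∑ L, c K L • (y K ν * y L μ) := by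
  classical
  refine ⟨fun K L => ∑ i, if p i = K then (if q i = L then c i else 0) else 0, fun μ ν => ?_⟩
  rw [h]
  simp_rw [Finset.sum_smul, ite_smul, zero_smul]
  symm
  calc _ = ∑ K, ∑ i, ∑ L, (if p i = K then
        (if q i = L then c i • (y K ν * y L μ) else 0) else 0) :=
        Finset.sum_congr rfl fun K _ => Finset.sum_comm
    _ = ∑ i, ∑ K, ∑ L, (if p i = K then
        (if q i = L then c i • (y K ν * y L μ) else 0) else 0) := Finset.sum_comm
    _ = _ := by
        refine Finset.sum_congr rfl fun i _ => ?_
        rw [Finset.sum_eq_single (p i)]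
        · simp
        · intro K _ hK
          simp [hK.symm]
        · simp

include hR hc he in
theorem sphereFrame_isExchangeFrame : IsExchangeFrame (sphereFrame R) where
  orth := sphereFrame_orth R
  exchange I J := by
    rcases I with l | a <;> rcases J with m | b
    · exact exists_exchange_coeff (κ := Unit) (fun _ => 1) (fun _ => Sum.inl m)
        (fun _ => Sum.inl l) fun μ ν => by simp [(sphereFrame_comm R l m μ ν).1]
    · exact exists_exchange_coeff (κ := Fin 4 × Fin 4) (fun i => R l b i.1 i.2)
        (fun i => Sum.inr i.1) (fun i => Sum.inl i.2) fun μ ν => by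
          rw [sphereFrame_mixed hc he, Fintype.sum_prod_type]
    · exact exists_exchange_coeff (κ := Fin 4 × Fin 4) (fun i => conj (R m a i.1 i.2))
        (fun i => Sum.inl i.2) (fun i => Sum.inr i.1) fun μ ν => by
          rw [sphereFrame_mixed' hR hc he, Fintype.sum_prod_type]
    · exact exists_exchange_coeff (κ := Unit) (fun _ => 1) (fun _ => Sum.inr b)
        (fun _ => Sum.inr a) fun μ ν => by simp [(sphereFrame_comm R a b μ ν).2]

end Exchange

/-! ### The four-sphere -/

/-- The real part of x_j e_μ is the e_μ-component of the adjoint of x_j. -/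
theorem proj_eq_frameProj (R : DefMatrix) (i j : Fin 2) (l : Fin 4) :
    Sphere7.proj R i j l = frameProj (sphereFrame R) (ketIdx i l) (ketIdx j 0) := by
  have hs : ∀ k, star (Sphere7.ket R j k) = Sphere7.ket R j k := fun k => by
    rw [ket_eq, Sphere7.star_x]
  rw [Sphere7.proj, frameProj]
  simp only [sphereFrame_ketIdx]
  generalize Sphere7.ket R i = a
  generalize Sphere7.ket R j = b at hs ⊢
  fin_cases l <;>
    simp [qmul, qstar, hs, rmul, rightMat, Fin.sum_univ_four] <;> abel

theorem sum_rmul_mul_rmul_eq {A : Type*} [Ring A] (a b : Fin 4 → A) (l m : Fin 4) :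
    ∑ μ, rmul a μ l * rmul b μ m =
      ∑ k, ∑ n, (∑ μ, rightMat μ l k * rightMat μ m n) • (a k * b n) := by
  simp only [rmul, Finset.sum_mul_sum, smul_mul_smul_comm, Finset.sum_smul]
  rw [Finset.sum_comm]
  exact Finset.sum_congr rfl fun k _ => Finset.sum_comm

/-- For fixed i, j the 4 × 4 block of yyᵀ is the matrix of left multiplication by the quaternion x_i
x_j^*, so it contains no new elements. -/
theorem frameProj_mem_adjoin (R : DefMatrix) (I J : Idx) : frameProj (sphereFrame R) I J ∈
    Algebra.adjoin ℂ {z | ∃ i j μ, z = Sphere7.proj R i j μ} := by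
  have hI : ∀ I : Idx, ∃ i l, I = ketIdx i l := by
    rintro (l | l)
    · exact ⟨1, l, rfl⟩
    · exact ⟨0, l, rfl⟩
  obtain ⟨i, l, rfl⟩ := hI I
  obtain ⟨j, m, rfl⟩ := hI J
  -- The signed factor is `rightMat m l p`, because E_m is antisymmetric for m ≠ 0.
  have hcoef : ∀ l m k n : Fin 4, ∑ μ, rightMat μ l k * rightMat μ m n =
      ∑ p, ((if m = 0 then 1 else -1) * rightMat m p l) *
        ∑ μ, rightMat μ p k * rightMat μ 0 n := by decide
  have key : frameProj (sphereFrame R) (ketIdx i l) (ketIdx j m) =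
      ∑ p, ((if m = 0 then 1 else -1) * rightMat m p l : ℤ) • Sphere7.proj R i j p := by
    simp only [proj_eq_frameProj, frameProj, sphereFrame_ketIdx, sum_rmul_mul_rmul_eq]
    simp_rw [hcoef l m, Finset.smul_sum, smul_smul, Finset.sum_smul (s := Finset.univ (α := Fin 4))]
    exact (Finset.sum_congr rfl fun k _ => Finset.sum_comm).trans Finset.sum_comm
  rw [key]
  refine Subalgebra.sum_mem _ fun p _ => zsmul_mem ?_ _
  exact Algebra.subset_adjoin ⟨i, j, p, rfl⟩

/-- The frame is hermitian, so the star only transposes yyᵀ and taking the star-closure adds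
nothing. -/
theorem fourSphere_eq (R : DefMatrix) :
    (Sphere7.fourSphere R).toSubalgebra = frameBase (sphereFrame R) := by
  have hstar : ∀ I J, star (frameProj (sphereFrame R) I J) = frameProj (sphereFrame R) J I := by
    intro I J
    simp [frameProj, star_sphereFrame]
  rw [Sphere7.fourSphere, StarAlgebra.adjoin_toSubalgebra]
  apply le_antisymm
  · refine Algebra.adjoin_le ?_
    rintro z (⟨i, j, l, rfl⟩ | ⟨i, j, l, hz⟩)
    · rw [proj_eq_frameProj]
      exact frameProj_mem _ _ _
    · rw [← star_star z, hz, proj_eq_frameProj, hstar]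
      exact frameProj_mem _ _ _
  · refine Algebra.adjoin_le ?_
    rintro _ ⟨I, J, rfl⟩
    exact Algebra.adjoin_mono Set.subset_union_left (frameProj_mem_adjoin R I J)

/-! ### The coaction -/

/-- The images `x w` of the coordinates under the coaction. -/
def coactGen (R : DefMatrix) (I : Idx) : Sphere7 R ⊗[ℂ] CoordSU2 :=
  ∑ ν, sphereFrame R I ν ⊗ₜ CoordSU2.w ν

/-- The exchange swaps the columns μ and ν, and commutativity of the w's swaps them back. -/
theorem coactGen_mul {R : DefMatrix} {I J : Idx} {κ : Type*} [Fintype κ] (c : κ → ℂ) (p q : κ → Idx)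
    (h : ∀ μ ν, sphereFrame R I μ * sphereFrame R J ν =
      ∑ i, c i • (sphereFrame R (p i) ν * sphereFrame R (q i) μ)) :
    coactGen R I * coactGen R J = ∑ i, c i • (coactGen R (p i) * coactGen R (q i)) := by
  simp only [coactGen, Finset.sum_mul_sum, Algebra.TensorProduct.tmul_mul_tmul, h,
    TensorProduct.sum_tmul, Finset.smul_sum, ← TensorProduct.smul_tmul']
  calc _ = ∑ μ, ∑ i, ∑ ν, c i • ((sphereFrame R (p i) ν * sphereFrame R (q i) μ) ⊗ₜ[ℂ]
        (CoordSU2.w μ * CoordSU2.w ν)) := Finset.sum_congr rfl fun μ _ => Finset.sum_comm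
    _ = ∑ i, ∑ μ, ∑ ν, c i • ((sphereFrame R (p i) ν * sphereFrame R (q i) μ) ⊗ₜ[ℂ]
        (CoordSU2.w μ * CoordSU2.w ν)) := Finset.sum_comm
    _ = _ := by
        refine Finset.sum_congr rfl fun i _ => ?_
        rw [Finset.sum_comm]
        exact Finset.sum_congr rfl fun μ _ => Finset.sum_congr rfl fun ν _ => by
          rw [mul_comm (CoordSU2.w ν)]

theorem coactGen_unit (R : DefMatrix) : ∑ I, coactGen R I ^ 2 = 1 := by
  simp only [coactGen, sq, Finset.sum_mul_sum, Algebra.TensorProduct.tmul_mul_tmul]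
  rw [Finset.sum_comm]
  have h : ∀ μ, ∑ I, ∑ ν, (sphereFrame R I μ * sphereFrame R I ν) ⊗ₜ[ℂ]
      (CoordSU2.w μ * CoordSU2.w ν) = 1 ⊗ₜ (CoordSU2.w μ ^ 2) := by
    intro μ
    rw [Finset.sum_comm]
    simp_rw [← TensorProduct.sum_tmul, sphereFrame_orth]
    rw [Finset.sum_eq_single μ]
    · simp [sq]
    · intro ν _ hν
      simp [hν.symm]
    · simp
  simp_rw [h, ← TensorProduct.tmul_sum, Fin.sum_univ_four, CoordSU2.w_rel]
  rfl

section Coaction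

variable {R : DefMatrix} (hR : IsDeformation R)
  (hc : ∀ k l m, slice R l m * unitMat ℂ k = unitMat ℂ k * slice R l m)
  (he : ∀ k l m, ∑ n, unitMat ℂ k l n • slice R n m + unitMat ℂ k * slice R l m =
    slice R l m * unitMat ℂ k + ∑ n, unitMat ℂ k n m • slice R l n)

include hR hc he in
theorem exists_coactHom : ∃ δ : Sphere7 R →ₐ[ℂ] Sphere7 R ⊗[ℂ] CoordSU2,
    ∀ I, δ (Sphere7.x R I) = coactGen R I := by
  have hrel : ∀ ⦃x y⦄, QuadRel R x y →
      FreeAlgebra.lift ℂ (coactGen R) x = FreeAlgebra.lift ℂ (coactGen R) y := by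
    intro x y h
    cases h with
    | comm₁ l m =>
      simp only [map_mul, FreeAlgebra.lift_ι_apply]
      simpa using coactGen_mul (κ := Unit) (fun _ => 1) (fun _ => Sum.inl m)
        (fun _ => Sum.inl l) fun μ ν => by simp [(sphereFrame_comm R l m μ ν).1]
    | comm₂ a b =>
      simp only [map_mul, FreeAlgebra.lift_ι_apply]
      simpa using coactGen_mul (κ := Unit) (fun _ => 1) (fun _ => Sum.inr b)
        (fun _ => Sum.inr a) fun μ ν => by simp [(sphereFrame_comm R a b μ ν).2]
    | mixed l a =>
      simp only [map_mul, map_sum, FreeAlgebra.lift_ι_apply, ← Algebra.smul_def, map_smul]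
      rw [coactGen_mul (κ := Fin 4 × Fin 4) (fun i => R l a i.1 i.2)
        (fun i => Sum.inr i.1) (fun i => Sum.inl i.2) fun μ ν => by
          rw [sphereFrame_mixed hc he, Fintype.sum_prod_type], Fintype.sum_prod_type]
    | mixed' l a =>
      simp only [map_mul, map_sum, FreeAlgebra.lift_ι_apply, ← Algebra.smul_def, map_smul]
      rw [coactGen_mul (κ := Fin 4 × Fin 4) (fun i => conj (R l a i.1 i.2))
        (fun i => Sum.inl i.2) (fun i => Sum.inr i.1) fun μ ν => by
          rw [sphereFrame_mixed' hR hc he, Fintype.sum_prod_type], Fintype.sum_prod_type]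
  let F : QuadAlg R →ₐ[ℂ] Sphere7 R ⊗[ℂ] CoordSU2 :=
    RingQuot.liftAlgHom ℂ ⟨FreeAlgebra.lift ℂ (coactGen R), hrel⟩
  have hF : ∀ I, F (QuadAlg.gen R I) = coactGen R I := by
    intro I
    have := RingQuot.liftAlgHom_mkAlgHom_apply ℂ (FreeAlgebra.lift ℂ (coactGen R)) hrel
      (FreeAlgebra.ι ℂ I)
    rw [FreeAlgebra.lift_ι_apply] at this
    exact this
  have hsphere : ∀ ⦃x y⦄, SphereRel R x y → F x = F y := by
    intro x y h
    cases h
    have := coactGen_unit R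
    rw [Fintype.sum_sum_type] at this
    simp only [QuadAlg.sq₁, QuadAlg.sq₂, QuadAlg.x₁, QuadAlg.x₂, map_add, map_sum, map_pow, hF,
      map_one, this]
  refine ⟨RingQuot.liftAlgHom ℂ ⟨F, hsphere⟩, fun I => ?_⟩
  have := RingQuot.liftAlgHom_mkAlgHom_apply ℂ F hsphere (QuadAlg.gen R I)
  exact this.trans (hF I)

end Coaction

section Properties

variable {R : DefMatrix} {δ : Sphere7 R →ₐ[ℂ] Sphere7 R ⊗[ℂ] CoordSU2}
  (hδ : ∀ I, δ (Sphere7.x R I) = coactGen R I)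
include hδ

theorem coact_star (a : Sphere7 R) : δ (star a) = star (δ a) := by
  have ha : a ∈ Algebra.adjoin ℂ (Set.range (Sphere7.x R)) := by
    rw [Sphere7.adjoin_x]; trivial
  have hw : ∀ ν, star (CoordSU2.w ν) = CoordSU2.w ν := CoordSU2.starHom_w
  induction ha using Algebra.adjoin_induction with
  | mem a ha =>
    obtain ⟨I, rfl⟩ := ha
    simp only [Sphere7.star_x, hδ, coactGen, star_sum, TensorProduct.star_tmul, star_sphereFrame,
      hw]
  | algebraMap c =>
    rw [AlgHom.commutes, ← algebraMap_star_comm, ← algebraMap_star_comm, AlgHom.commutes]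
  | add a b _ _ ha hb => rw [star_add, map_add, map_add, star_add, ha, hb]
  | mul a b _ _ ha hb => rw [star_mul, map_mul, map_mul, star_mul, ha, hb]

theorem coact_ket (i : Fin 2) (μ : Fin 4) : δ (Sphere7.ket R i μ) =
    qmul (fun ν => Sphere7.ket R i ν ⊗ₜ[ℂ] (1 : CoordSU2))
      (fun ν => (1 : Sphere7 R) ⊗ₜ[ℂ] CoordSU2.w ν) μ := by
  rw [ket_eq, hδ, coactGen, qmul_eq_sum]
  simp only [sphereFrame_ketIdx, rmul, TensorProduct.sum_tmul,
    Algebra.TensorProduct.tmul_mul_tmul, one_mul, mul_one]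
  exact Finset.sum_congr rfl fun ν _ => Finset.sum_congr rfl fun k _ =>
    (TensorProduct.smul_tmul' _ _ _).symm

theorem coact_eval {α : unitary ℍ[ℝ] → (Sphere7 R ≃⋆ₐ[ℂ] Sphere7 R)}
    (hα : ∀ (u : unitary ℍ[ℝ]) (i : Fin 2) (μ : Fin 4),
      α u (Sphere7.ket R i μ) = qmul (Sphere7.ket R i) (qscalar (Sphere7 R) u) μ)
    (u : unitary ℍ[ℝ]) (p : Sphere7 R) : Algebra.TensorProduct.rid ℂ ℂ (Sphere7 R)
      (Algebra.TensorProduct.map (AlgHom.id ℂ (Sphere7 R)) (CoordSU2.eval u) (δ p)) = α u p := by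
  have h : ((Algebra.TensorProduct.rid ℂ ℂ (Sphere7 R)).toAlgHom.comp
      (Algebra.TensorProduct.map (AlgHom.id ℂ (Sphere7 R)) (CoordSU2.eval u))).comp δ =
      ((α u).toAlgEquiv : Sphere7 R →ₐ[ℂ] Sphere7 R) := by
    refine AlgHom.ext_of_adjoin_eq_top (Sphere7.adjoin_x R) ?_
    rintro _ ⟨I, rfl⟩
    have hI : ∃ i l, I = ketIdx i l := by
      rcases I with l | l
      · exact ⟨1, l, rfl⟩
      · exact ⟨0, l, rfl⟩
    obtain ⟨i, l, rfl⟩ := hI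
    have hev : ∀ ν, CoordSU2.eval u (CoordSU2.w ν) = ((qcoord u ν : ℝ) : ℂ) := fun ν =>
      CoordSU2.lift_w _ _ _
    have h1 : α u (Sphere7.x R (ketIdx i l)) =
        ∑ ν, ((qcoord u ν : ℝ) : ℂ) • rmul (Sphere7.ket R i) ν l := by
      rw [← ket_eq, hα, qmul_eq_sum]
      simp only [rmul, qscalar, Finset.smul_sum]
      refine Finset.sum_congr rfl fun ν _ => Finset.sum_congr rfl fun k _ => ?_
      rw [← Algebra.commutes, ← Algebra.smul_def, smul_comm]
    refine Eq.trans ?_ h1.symm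
    rw [AlgHom.comp_apply, hδ, coactGen, map_sum]
    refine Finset.sum_congr rfl fun ν _ => ?_
    rw [sphereFrame_ketIdx]
    simp [hev]
  exact DFunLike.congr_fun h p

/-- Associativity (x w)e_μ = x(w e_μ), in components: δ multiplies y on the right by the matrix W
with columns w e_μ. -/
theorem coact_frame (I : Idx) (μ : Fin 4) : δ (sphereFrame R I μ) =
    ∑ ν, sphereFrame R I ν ⊗ₜ rmul CoordSU2.w μ ν := by
  have hassoc : ∀ μ ν l n : Fin 4, ∑ k, rightMat μ l k * rightMat ν k n =
      ∑ p, rightMat p l n * rightMat μ p ν := by decide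
  have key : ∀ x : Fin 4 → Sphere7 R, (∀ l, δ (x l) = ∑ ν, rmul x ν l ⊗ₜ CoordSU2.w ν) →
      ∀ l, δ (rmul x μ l) = ∑ ν, rmul x ν l ⊗ₜ rmul CoordSU2.w μ ν := by
    intro x hx l
    have e1 : δ (rmul x μ l) = ∑ ν, ∑ n, (∑ k, rightMat μ l k * rightMat ν k n) •
        (x n ⊗ₜ[ℂ] CoordSU2.w ν) := by
      simp only [rmul, map_sum, map_zsmul, hx, TensorProduct.sum_tmul, Finset.smul_sum,
        Finset.sum_smul, mul_smul, TensorProduct.smul_tmul']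
      rw [Finset.sum_comm]
      exact Finset.sum_congr rfl fun ν _ => Finset.sum_comm
    have e2 : ∑ p, rmul x p l ⊗ₜ[ℂ] rmul CoordSU2.w μ p =
        ∑ ν, ∑ n, (∑ p, rightMat p l n * rightMat μ p ν) • (x n ⊗ₜ[ℂ] CoordSU2.w ν) := by
      have hz : ∀ (a b : ℤ) (y : Sphere7 R) (h : CoordSU2),
          (a • y) ⊗ₜ[ℂ] (b • h) = (a * b) • (y ⊗ₜ[ℂ] h) := by
        intro a b y h
        rw [TensorProduct.tmul_smul, ← TensorProduct.smul_tmul', smul_smul, mul_comm]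
      simp only [rmul, TensorProduct.sum_tmul, TensorProduct.tmul_sum, hz, Finset.sum_smul]
      calc _ = ∑ ν, ∑ p, ∑ n, (rightMat p l n * rightMat μ p ν) •
            (x n ⊗ₜ[ℂ] CoordSU2.w ν) := Finset.sum_comm
        _ = _ := Finset.sum_congr rfl fun ν _ => Finset.sum_comm
    rw [e1, e2]
    simp_rw [hassoc]
  cases I with
  | inl l => exact key _ (fun l => hδ (Sum.inl l)) l
  | inr a => exact key _ (fun a => hδ (Sum.inr a)) a

/-- The matrix W satisfies WWᵀ = 1, so y ↦ yW fixes yyᵀ. -/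
theorem frameBase_le_coinvariants : frameBase (sphereFrame R) ≤ coinvariants δ := by
  refine Algebra.adjoin_le ?_
  rintro _ ⟨I, J, rfl⟩
  change δ (frameProj (sphereFrame R) I J) = frameProj (sphereFrame R) I J ⊗ₜ 1
  have horth : ∀ l m, ∑ μ, rmul CoordSU2.w μ l * rmul CoordSU2.w μ m = if l = m then 1 else 0 := by
    intro l m
    rw [sum_rmul_mul_rmul' fun i j => mul_comm _ _, Fin.sum_univ_four, CoordSU2.w_rel]
  simp only [frameProj, map_sum, map_mul, coact_frame hδ, Finset.sum_mul_sum,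
    Algebra.TensorProduct.tmul_mul_tmul]
  rw [Finset.sum_comm, TensorProduct.sum_tmul]
  refine Finset.sum_congr rfl fun ν _ => ?_
  rw [Finset.sum_comm]
  simp_rw [← TensorProduct.tmul_sum, horth]
  rw [Finset.sum_eq_single ν]
  · simp
  · intro κ _ hκ
    simp [hκ.symm]
  · simp

theorem coact_isCoaction : IsCoaction δ where
  coassoc := by
    refine AlgHom.ext_of_adjoin_eq_top (Sphere7.adjoin_x R) ?_
    rintro _ ⟨I, rfl⟩
    have hΔ : ∀ ν, Bialgebra.comulAlgHom ℂ CoordSU2 (CoordSU2.w ν) =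
        ∑ κ, rmul CoordSU2.w κ ν ⊗ₜ CoordSU2.w κ := by
      intro ν
      rw [CoordSU2.comulAlgHom_w, qmul_eq_sum]
      simp only [rmul, TensorProduct.sum_tmul, Algebra.TensorProduct.tmul_mul_tmul, one_mul,
        mul_one]
      exact Finset.sum_congr rfl fun κ _ => Finset.sum_congr rfl fun k _ =>
        (TensorProduct.smul_tmul' _ _ _).symm
    simp only [AlgHom.comp_apply, hδ, coactGen, map_sum, Algebra.TensorProduct.map_tmul,
      coact_frame hδ, TensorProduct.sum_tmul, hΔ, TensorProduct.tmul_sum, AlgHom.id_apply]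
    rw [Finset.sum_comm]
    rfl
  counit := by
    refine AlgHom.ext_of_adjoin_eq_top (Sphere7.adjoin_x R) ?_
    rintro _ ⟨I, rfl⟩
    have hε : ∀ ν, CoalgebraStruct.counit (R := ℂ) (CoordSU2.w ν) = ![(1 : ℂ), 0, 0, 0] ν :=
      CoordSU2.counitAlgHom_w
    simp [hδ, coactGen, hε, Fin.sum_univ_four, sphereFrame_zero]

end Properties

end QuaternionicSphere

end

open QuaternionicSphere in
theorem mainTheorem1 (R : DefMatrix) (hR : IsDeformation R)
    (α : unitary ℍ[ℝ] → (Sphere7 R ≃⋆ₐ[ℂ] Sphere7 R))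
    (hα : ∀ (u : unitary ℍ[ℝ]) (i : Fin 2) (μ : Fin 4),
      α u (Sphere7.ket R i μ) = qmul (Sphere7.ket R i) (qscalar (Sphere7 R) u) μ) :
    ∃ δ : Sphere7 R →⋆ₐ[ℂ] Sphere7 R ⊗[ℂ] CoordSU2,
      (∀ (u : unitary ℍ[ℝ]) (p : Sphere7 R),
        Algebra.TensorProduct.rid ℂ ℂ (Sphere7 R)
          (Algebra.TensorProduct.map (AlgHom.id ℂ (Sphere7 R)) (CoordSU2.eval u) (δ p)) = α u p) ∧
      (∀ (i : Fin 2) (μ : Fin 4), δ (Sphere7.ket R i μ) =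
        qmul (fun ν => Sphere7.ket R i ν ⊗ₜ[ℂ] (1 : CoordSU2))
          (fun ν => (1 : Sphere7 R) ⊗ₜ[ℂ] CoordSU2.w ν) μ) ∧
      IsCoaction δ.toAlgHom ∧
      IsHopfGalois δ.toAlgHom (Sphere7.fourSphere R).toSubalgebra := by
  -- The existence of δ and the Hopf–Galois property use the automorphisms only through these two
  -- identities.
  have he := slice_equivariant hR α hα
  have hc := slice_commute hR α hα
  obtain ⟨δ, hδ⟩ := exists_coactHom hR hc he
  refine ⟨{ δ with map_star' := coact_star hδ }, coact_eval hδ hα, coact_ket hδ,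
    coact_isCoaction hδ, ?_⟩
  rw [fourSphere_eq]
  refine (sphereFrame_isExchangeFrame hR hc he).isHopfGalois (δ := δ) (fun I => ?_) ?_
    (frameBase_le_coinvariants hδ)
  · rw [sphereFrame_zero, hδ, coactGen]
  · simp_rw [sphereFrame_zero]
    exact Sphere7.adjoin_x R
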